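/- Let $\Omega\subset\mathbb C$ be a bounded $n$-connected domain with $C^\infty$ smooth boundary: $\partial\Omega$ is the union of $n$ pairwise disjoint $C^\infty$ regular simple closed curves $z=z(t)$, each with parameter of period $1$ and oriented so that $iz'(t)$ points into $\Omega$. Let $T(z(t))=z'(t)/|z'(t)|$ be the unit tangent and $ds=|z'(t)|\,dt$ arc length, and let $\varphi$ be a positive $C^\infty$ function on $\partial\Omega$. Let $L^2_\varphi(\partial\Omega)$ be the Hilbert space with inner product $\langle u,v\rangle_\varphi=\int_{\partial\Omega}u\bar v\,\varphi\,ds$. Let $A^\infty(\Omega)$ be the space of holomorphic functions on $\Omega$ that are in $C^\infty(\overline\Omega)$, let $H^2(\partial\Omega)$ be the closure in $L^2_\varphi(\partial\Omega)$ of the set of boundary values of functions in $A^\infty(\Omega)$, and let $P_\varphi$ be the orthogonal projection of $L^2_\varphi(\partial\Omega)$ onto $H^2(\partial\Omega)$ (the weighted Szegő projection). For $u\in C^\infty(\partial\Omega)$ let $$(\mathcal Cu)(z)=\frac1{2\pi i}\int_{\partial\Omega}\frac{u(\zeta)}{\zeta-z}\,d\zeta\quad(z\in\Omega),$$ extended to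 $\partial\Omega$ by its limits from inside $\Omega$, and let $$\mathcal C^*_\varphi u=u-\overline T\,\varphi^{-1}\,\overline{\mathcal C(\overline{u\varphi}\,\overline T)}\quad\text{on }\partial\Omega .$$ 1. For every $u\in C^\infty(\partial\Omega)$ the limits defining $\mathcal Cu$ on $\partial\Omega$ exist, $\mathcal Cu\in A^\infty(\Omega)$, and $\mathcal Cu$, $\mathcal C^*_\varphi u$ are in $C^\infty(\partial\Omega)$. For all $u,v\in C^\infty(\partial\Omega)$, $\langle\mathcal Cu,v\rangle_\varphi=\langle u,\mathcal C^*_\varphi v\rangle_\varphi$. 2. (Weighted Kerzman–Stein formula.) With $\mathcal A_\varphi=\mathcal C-\mathcal C^*_\varphi$, $$P_\varphi(I+\mathcal A_\varphi)=\mathcal C\quad\text{on }C^\infty(\partial\Omega).$$ 3. $\mathcal C$ extends uniquely from $C^\infty(\partial\Omega)$ to a bounded operator, again denoted $\mathcal C$, on $L^2_\varphi(\partial\Omega)$; with $\mathcal C^*_\varphi$ now its adjoint in $L^2_\varphi(\partial\Omega)$ and $\mathcal A_\varphi=\mathcal C-\mathcal C^*_\varphi$, the identity $P_\varphi(I+\mathcal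 A_\varphi)=\mathcal C$ holds on all of $L^2_\varphi(\partial\Omega)$. -/

import Mathlib

open Set Filter Topology MeasureTheory
open scoped ContDiff ComplexConjugate

noncomputable section

namespace WeightedSzego

/-- `Ω` is a bounded domain in the plane whose boundary consists of the `n` pairwise disjoint
`C^∞` smooth simple closed curves parametrized by `γ 0, …, γ (n - 1)` (so `Ω` is `n`-connected),
each `γ i` being regular, of period one, and traversed in the standard sense: `I * γ'` points
into `Ω`, and `-I * γ'` points out of `Ω`. -/
structure IsSmoothDomain {n : ℕ} (Ω : Set ℂ) (γ : Fin n → ℝ → ℂ) : Prop where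
  isOpen : IsOpen Ω
  isConnected : IsConnected Ω
  isBounded : Bornology.IsBounded Ω
  contDiff : ∀ i, ContDiff ℝ ∞ (γ i)
  periodic : ∀ i, Function.Periodic (γ i) 1
  deriv_ne_zero : ∀ i t, deriv (γ i) t ≠ 0
  simple : ∀ i j, ∀ s ∈ Ico (0 : ℝ) 1, ∀ t ∈ Ico (0 : ℝ) 1, γ i s = γ j t → i = j ∧ s = t
  frontier_eq : frontier Ω = ⋃ i, range (γ i)
  left_mem : ∀ i t, ∀ᶠ r : ℝ in 𝓝[>] 0, γ i t + r * (Complex.I * deriv (γ i) t) ∈ Ω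
  right_notMem : ∀ i t, ∀ᶠ r : ℝ in 𝓝[<] 0, γ i t + r * (Complex.I * deriv (γ i) t) ∉ Ω

variable {n : ℕ}

/-- `u ∈ C^∞(∂Ω)`. Functions on `∂Ω` are represented by functions on `ℂ`, of which only the
values on `∂Ω` are ever used. -/
def BdrySmooth {E : Type*} [NormedAddCommGroup E] [NormedSpace ℝ E]
    (γ : Fin n → ℝ → ℂ) (u : ℂ → E) : Prop :=
  ∀ i, ContDiff ℝ ∞ (fun t => u (γ i t))

/-- The complex unit tangent `T(γ(t)) = γ'(t) / |γ'(t)|` on `∂Ω` (and `0` elsewhere); that it does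
not depend on the choice of the parameter is `unitTangent_apply`. -/
def unitTangent (γ : Fin n → ℝ → ℂ) (z : ℂ) : ℂ :=
  open Classical in
  if h : ∃ p : Fin n × ℝ, γ p.1 p.2 = z then
    deriv (γ h.choose.1) h.choose.2 / (‖deriv (γ h.choose.1) h.choose.2‖ : ℂ)
  else 0

/-- The arc length measure `ds = |γ'(t)| dt` on `∂Ω`. -/
def arcLength (γ : Fin n → ℝ → ℂ) : Measure ℂ :=
  ∑ i, ((volume.restrict (Ico (0 : ℝ) 1)).withDensity
    (fun t => ENNReal.ofReal ‖deriv (γ i) t‖)).map (γ i)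

/-- The weighted arc length measure `φ ds` on `∂Ω`. -/
def weightedArc (γ : Fin n → ℝ → ℂ) (φ : ℂ → ℝ) : Measure ℂ :=
  (arcLength γ).withDensity (fun z => ENNReal.ofReal (φ z))

/-- The Hilbert space `L²_φ(∂Ω)`. -/
abbrev L2 (γ : Fin n → ℝ → ℂ) (φ : ℂ → ℝ) : Type := Lp ℂ 2 (weightedArc γ φ)

/-- The inner product `⟨u, v⟩_φ = ∫_{∂Ω} u v̄ φ ds`. -/
def wInner (γ : Fin n → ℝ → ℂ) (φ : ℂ → ℝ) (u v : ℂ → ℂ) : ℂ :=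
  ∫ z, u z * conj (v z) ∂(weightedArc γ φ)

/-- `h ∈ A^∞(Ω)`: `h` is holomorphic on `Ω` and all its derivatives extend continuously to the
closure of `Ω` (for holomorphic `h` every partial derivative is a power of `I` times a complex
derivative). The values of `h` on `∂Ω` are its boundary values. -/
def MemAInf (Ω : Set ℂ) (h : ℂ → ℂ) : Prop :=
  DifferentiableOn ℂ h Ω ∧ ContinuousOn h (closure Ω) ∧
    ∀ k : ℕ, ∃ g : ℂ → ℂ, ContinuousOn g (closure Ω) ∧ EqOn g (iteratedDeriv k h) Ω

/-- The Cauchy integral `(1 / 2πi) ∫_{∂Ω} u(ζ) / (ζ - z) dζ`. -/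
def cauchyIntegral (γ : Fin n → ℝ → ℂ) (u : ℂ → ℂ) (z : ℂ) : ℂ :=
  (2 * Real.pi * Complex.I)⁻¹ *
    ∑ i, ∫ t in (0 : ℝ)..1, u (γ i t) / (γ i t - z) * deriv (γ i) t

/-- The Cauchy transform `𝒞 u`: the Cauchy integral on `Ω`, extended to `∂Ω` by its limits
from inside `Ω`. -/
def cauchyTransform (Ω : Set ℂ) (γ : Fin n → ℝ → ℂ) (u : ℂ → ℂ) : ℂ → ℂ :=
  extendFrom Ω (cauchyIntegral γ u)

/-- `𝒞*_φ v = v - T̄ φ⁻¹ conj (𝒞 (conj (v φ) T̄))` for `v ∈ C^∞(∂Ω)`. -/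
def cauchyAdjoint (Ω : Set ℂ) (γ : Fin n → ℝ → ℂ) (φ : ℂ → ℝ) (v : ℂ → ℂ) (z : ℂ) : ℂ :=
  v z - conj (unitTangent γ z) * (φ z : ℂ)⁻¹ *
    conj (cauchyTransform Ω γ (fun ζ => conj (v ζ * (φ ζ : ℂ)) * conj (unitTangent γ ζ)) z)

theorem unitTangent_apply {Ω : Set ℂ} {γ : Fin n → ℝ → ℂ} (hΩ : IsSmoothDomain Ω γ)
    (i : Fin n) (t : ℝ) :
    unitTangent γ (γ i t) = deriv (γ i) t / (‖deriv (γ i) t‖ : ℂ) := by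
  have key : ∀ (j : Fin n) (s : ℝ), γ j s = γ i t → deriv (γ j) s = deriv (γ i) t := by
    intro j s hjs
    have hf : ∀ (j : Fin n) (s : ℝ), γ j (Int.fract s) = γ j s := fun j s => by
      have := (hΩ.periodic j).sub_int_mul_eq (x := s) ⌊s⌋
      rwa [mul_one] at this
    have hd : ∀ (j : Fin n) (s : ℝ), deriv (γ j) (Int.fract s) = deriv (γ j) s := fun j s => by
      have hp : (fun x => γ j (x - (⌊s⌋ : ℝ))) = γ j := by
        funext x
        have := (hΩ.periodic j).sub_int_mul_eq (x := x) ⌊s⌋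
        rwa [mul_one] at this
      have := deriv_comp_sub_const (f := γ j) (a := (⌊s⌋ : ℝ)) (x := s)
      rw [hp] at this
      exact this.symm
    have h := hΩ.simple j i (Int.fract s) ⟨Int.fract_nonneg s, Int.fract_lt_one s⟩
      (Int.fract t) ⟨Int.fract_nonneg t, Int.fract_lt_one t⟩ (by rw [hf, hf, hjs])
    obtain ⟨rfl, h2⟩ := h
    rw [← hd, h2, hd]
  have hex : ∃ p : Fin n × ℝ, γ p.1 p.2 = γ i t := ⟨(i, t), rfl⟩
  rw [unitTangent, dif_pos hex, key _ _ hex.choose_spec]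

theorem continuousOn_of_bdrySmooth {E : Type*} [NormedAddCommGroup E] [NormedSpace ℝ E]
    {Ω : Set ℂ} {γ : Fin n → ℝ → ℂ} (hΩ : IsSmoothDomain Ω γ) {u : ℂ → E}
    (hu : BdrySmooth γ u) : ContinuousOn u (frontier Ω) := by
  rw [continuousOn_iff_isClosed]
  intro F hF
  refine ⟨⋃ i, γ i '' (Icc (0 : ℝ) 1 ∩ (fun t => u (γ i t)) ⁻¹' F), ?_, ?_⟩
  · refine isClosed_iUnion_of_finite fun i => ?_
    refine IsCompact.isClosed (IsCompact.image ?_ (hΩ.contDiff i).continuous)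
    exact isCompact_Icc.inter_right (hF.preimage (hu i).continuous)
  · ext z
    constructor
    · rintro ⟨hz, hfz⟩
      refine ⟨?_, hfz⟩
      rw [hΩ.frontier_eq] at hfz
      obtain ⟨i, t, rfl⟩ := mem_iUnion.1 hfz
      have hf : γ i (Int.fract t) = γ i t := by
        have := (hΩ.periodic i).sub_int_mul_eq (x := t) ⌊t⌋
        rwa [mul_one] at this
      refine mem_iUnion.2 ⟨i, Int.fract t,
        ⟨⟨Int.fract_nonneg t, (Int.fract_lt_one t).le⟩, ?_⟩, hf⟩
      simpa [hf] using hz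
    · rintro ⟨hz, hfz⟩
      obtain ⟨i, t, ⟨-, ht⟩, rfl⟩ := mem_iUnion.1 hz
      exact ⟨ht, hfz⟩

theorem ae_mem_frontier {Ω : Set ℂ} {γ : Fin n → ℝ → ℂ} (hΩ : IsSmoothDomain Ω γ) :
    ∀ᵐ z ∂(arcLength γ), z ∈ frontier Ω := by
  rw [ae_iff, arcLength, Measure.finsetSum_apply]
  refine Finset.sum_eq_zero fun i _ => ?_
  have hm : MeasurableSet {z : ℂ | z ∉ frontier Ω} := isClosed_frontier.measurableSet.compl
  rw [Measure.map_apply (hΩ.contDiff i).continuous.measurable hm]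
  have he : γ i ⁻¹' {z : ℂ | z ∉ frontier Ω} = ∅ := by
    refine eq_empty_of_forall_notMem fun t ht => ht ?_
    rw [hΩ.frontier_eq]
    exact mem_iUnion.2 ⟨i, t, rfl⟩
  rw [he, measure_empty]

theorem isCompact_frontier {Ω : Set ℂ} {γ : Fin n → ℝ → ℂ} (hΩ : IsSmoothDomain Ω γ) :
    IsCompact (frontier Ω) :=
  Metric.isCompact_of_isClosed_isBounded isClosed_frontier
    (hΩ.isBounded.closure.subset frontier_subset_closure)

theorem isFiniteMeasure_arcLength {Ω : Set ℂ} {γ : Fin n → ℝ → ℂ} (hΩ : IsSmoothDomain Ω γ) :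
    IsFiniteMeasure (arcLength γ) := by
  refine ⟨?_⟩
  rw [arcLength, Measure.finsetSum_apply]
  refine ENNReal.sum_lt_top.2 fun i _ => ?_
  rw [Measure.map_apply (hΩ.contDiff i).continuous.measurable MeasurableSet.univ, preimage_univ,
    withDensity_apply _ MeasurableSet.univ, Measure.restrict_univ]
  have hc : Continuous (deriv (γ i)) := (hΩ.contDiff i).continuous_deriv (by simp)
  have : IntegrableOn (deriv (γ i)) (Ico 0 1) :=
    (hc.continuousOn.integrableOn_compact isCompact_Icc).mono_set Ico_subset_Icc_self
  simpa [ofReal_norm, HasFiniteIntegral] using this.2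

theorem isFiniteMeasure_weightedArc {Ω : Set ℂ} {γ : Fin n → ℝ → ℂ} (hΩ : IsSmoothDomain Ω γ)
    {φ : ℂ → ℝ} (hφ : BdrySmooth γ φ) : IsFiniteMeasure (weightedArc γ φ) := by
  have := isFiniteMeasure_arcLength hΩ
  obtain ⟨B, hB⟩ :=
    (isCompact_frontier hΩ).exists_bound_of_continuousOn (continuousOn_of_bdrySmooth hΩ hφ)
  refine isFiniteMeasure_withDensity (ne_of_lt ?_)
  calc ∫⁻ z, ENNReal.ofReal (φ z) ∂(arcLength γ)
      ≤ ∫⁻ _, ENNReal.ofReal B ∂(arcLength γ) := by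
        refine lintegral_mono_ae ?_
        filter_upwards [ae_mem_frontier hΩ] with z hz
        exact ENNReal.ofReal_le_ofReal ((le_abs_self _).trans (hB z hz))
    _ < ⊤ := by
        rw [lintegral_const]
        exact ENNReal.mul_lt_top ENNReal.ofReal_lt_top (measure_lt_top _ _)

/-- `C^∞(∂Ω)` is contained in `L²_φ(∂Ω)`. -/
theorem BdrySmooth.memLp {Ω : Set ℂ} {γ : Fin n → ℝ → ℂ} (hΩ : IsSmoothDomain Ω γ)
    {φ : ℂ → ℝ} (hφ : BdrySmooth γ φ) {u : ℂ → ℂ} (hu : BdrySmooth γ u) :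
    MemLp u 2 (weightedArc γ φ) := by
  have := isFiniteMeasure_weightedArc hΩ hφ
  have hc := continuousOn_of_bdrySmooth hΩ hu
  have hae : ∀ᵐ z ∂(weightedArc γ φ), z ∈ frontier Ω :=
    (withDensity_absolutelyContinuous _ _).ae_le (ae_mem_frontier hΩ)
  obtain ⟨B, hB⟩ := (isCompact_frontier hΩ).exists_bound_of_continuousOn hc
  refine MemLp.of_bound ?_ B (hae.mono hB)
  have h := hc.aestronglyMeasurable (μ := weightedArc γ φ) isClosed_frontier.measurableSet
  rwa [Measure.restrict_eq_self_of_ae_mem hae] at h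

/-- The element of `L²_φ(∂Ω)` given by `u ∈ C^∞(∂Ω)`. -/
def toL2 {Ω : Set ℂ} {γ : Fin n → ℝ → ℂ} (hΩ : IsSmoothDomain Ω γ)
    {φ : ℂ → ℝ} (hφ : BdrySmooth γ φ) {u : ℂ → ℂ} (hu : BdrySmooth γ u) : L2 γ φ :=
  (BdrySmooth.memLp hΩ hφ hu).toLp u

/-- `A^∞(∂Ω)`, the boundary values of functions in `A^∞(Ω)`, as a subspace of `L²_φ(∂Ω)`. -/
def aInfBdry (Ω : Set ℂ) (hΩ : IsOpen Ω) (γ : Fin n → ℝ → ℂ) (φ : ℂ → ℝ) :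
    Submodule ℂ (L2 γ φ) where
  carrier := {f | ∃ h : ℂ → ℂ, MemAInf Ω h ∧ f =ᵐ[weightedArc γ φ] h}
  zero_mem' := by
    refine ⟨0, ⟨differentiableOn_const 0, continuousOn_const, fun k => ⟨0, continuousOn_const, ?_⟩⟩,
      Lp.coeFn_zero _ _ _⟩
    intro z _
    simp
  add_mem' := by
    rintro f₁ f₂ ⟨h₁, ⟨hd₁, hc₁, hk₁⟩, he₁⟩ ⟨h₂, ⟨hd₂, hc₂, hk₂⟩, he₂⟩
    refine ⟨h₁ + h₂, ⟨hd₁.add hd₂, hc₁.add hc₂, fun k => ?_⟩,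
      (Lp.coeFn_add _ _).trans (he₁.add he₂)⟩
    obtain ⟨g₁, hg₁, e₁⟩ := hk₁ k
    obtain ⟨g₂, hg₂, e₂⟩ := hk₂ k
    refine ⟨g₁ + g₂, hg₁.add hg₂, fun z hz => ?_⟩
    have c₁ : ContDiffAt ℂ k h₁ z := (hd₁.analyticAt (hΩ.mem_nhds hz)).contDiffAt
    have c₂ : ContDiffAt ℂ k h₂ z := (hd₂.analyticAt (hΩ.mem_nhds hz)).contDiffAt
    rw [iteratedDeriv_add c₁ c₂, Pi.add_apply, e₁ hz, e₂ hz]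
  smul_mem' := by
    rintro c f ⟨h, ⟨hd, hc, hk⟩, he⟩
    refine ⟨c • h, ⟨hd.const_smul c, hc.const_smul c, fun k => ?_⟩,
      (Lp.coeFn_smul _ _).trans (he.const_smul c)⟩
    obtain ⟨g, hg, e⟩ := hk k
    refine ⟨c • g, hg.const_smul c, fun z hz => ?_⟩
    have c₁ : ContDiffAt ℂ k h z := (hd.analyticAt (hΩ.mem_nhds hz)).contDiffAt
    rw [iteratedDeriv_const_smul c₁, Pi.smul_apply, e hz]

/-- The Hardy space `H²(∂Ω)`: the closure of `A^∞(∂Ω)` in `L²_φ(∂Ω)`. -/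
abbrev hardy (Ω : Set ℂ) (hΩ : IsOpen Ω) (γ : Fin n → ℝ → ℂ) (φ : ℂ → ℝ) :
    Submodule ℂ (L2 γ φ) :=
  (aInfBdry Ω hΩ γ φ).topologicalClosure

/-- The weighted Szegő projection `P_φ`: the orthogonal projection of `L²_φ(∂Ω)` onto
`H²(∂Ω)`. -/
def szegoProj (Ω : Set ℂ) (hΩ : IsOpen Ω) (γ : Fin n → ℝ → ℂ) (φ : ℂ → ℝ) :
    L2 γ φ →L[ℂ] L2 γ φ :=
  (hardy Ω hΩ γ φ).starProjection

/-- The bounded operator `K` on `L²_φ(∂Ω)` extends the Cauchy transform on `C^∞(∂Ω)`. -/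
def ExtendsCauchy {Ω : Set ℂ} {γ : Fin n → ℝ → ℂ} (hΩ : IsSmoothDomain Ω γ)
    {φ : ℂ → ℝ} (hφ : BdrySmooth γ φ) (K : L2 γ φ →L[ℂ] L2 γ φ) : Prop :=
  ∀ (u : ℂ → ℂ) (hu : BdrySmooth γ u),
    ∃ hCu : BdrySmooth γ (cauchyTransform Ω γ u), K (toL2 hΩ hφ hu) = toL2 hΩ hφ hCu

end WeightedSzego

end

open WeightedSzego

/-!
# The weighted Kerzman–Stein formula

Write `𝒞` for the Cauchy transform, `𝒞*` for its formal adjoint, `T` for the unit tangent.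

*Boundary values.* For `u ∈ C^∞(∂Ω)` and `p ∈ ∂Ω` the boundary point nearest to `z`,
`𝒞 u(z) = u(p) N(z) + (2πi)⁻¹ ∫ (u(ζ) - u(p)) / (ζ - z) dζ`, where `N` is the winding number of
`∂Ω`. Since `|ζ - p| ≤ 2 |ζ - z|` and `u` is Lipschitz on `∂Ω`, the integrand is bounded, and
dominated convergence gives the one-sided limits of the Cauchy integral
(`tendsto_cauchyIntegral`). Comparing the Cauchy kernel of a curve with that of its tangent line
shows that `N` jumps by one across `∂Ω`; as `N` vanishes at infinity, it is `1` on `Ω` and `0`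
outside (`winding_of_mem`, `winding_of_notMem`). Integration by parts shows that the derivative of
`𝒞 u` is the Cauchy transform of the tangential derivative of `u`, so `𝒞 u ∈ A^∞(Ω)`
(`memAInf_cauchyTransform`).

*Cauchy's formula.* For `h ∈ A^∞(Ω)` the function equal to `𝒞 h - h` on the closure of `Ω` and to
the Cauchy integral of `h` outside is continuous, and so is its derivative, which is the same
function for `h'`. In collar coordinates one sees that `∂Ω` is removable for such functions. By
Liouville's theorem it vanishes (`cauchyDefect_eq_zero`). So `𝒞 h = h`, and Cauchy's theorem
`∫ h dζ = 0` follows.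

*The adjoint.* On the boundary, `𝒞 u · w + u · 𝒞 w - u w - 𝒞 (u w)` is the integral against `dζ`
of a bounded kernel which, multiplied by `T(z) T(ζ)`, is antisymmetric in `z` and `ζ`. Integrating
against `dz` and using Cauchy's theorem for `𝒞 (u w)` gives
`∫ 𝒞 u · w dz = ∫ u (w - 𝒞 w) dz` (`integral_cauchyTransform_mul`); for `w = conj (v φ T)` this is
`⟨𝒞 u, v⟩ = ⟨u, 𝒞* v⟩`.

*The Kerzman–Stein formula.* `𝒞 u` lies in the Hardy space, and `u - 𝒞* u` is orthogonal to
`A^∞(Ω)` since `⟨u - 𝒞* u, h⟩ = ⟨u, h - 𝒞 h⟩ = 0` (`szegoProj_kerzmanStein`).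

*Boundedness.* The singularities of `𝒞` and `𝒞*` cancel because `T(ζ) / (ζ - z)` is real up to a
bounded error, so `𝒞 - 𝒞*` is bounded on `L²` (`exists_norm_kerzmanStein_le`). With `𝒞² = 𝒞` this
gives `‖𝒞 u‖² = ⟨u, 𝒞* 𝒞 u⟩ = ⟨u, 𝒞 u⟩ - ⟨u, (𝒞 - 𝒞*) 𝒞 u⟩ ≤ const ‖u‖ ‖𝒞 u‖`, so `𝒞` is bounded.
Everything extends to `L²` by the density of `C^∞(∂Ω)`.
-/

noncomputable section

namespace WeightedSzego

variable {n : ℕ} {Ω : Set ℂ} {γ : Fin n → ℝ → ℂ} {φ : ℂ → ℝ}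

/-! ### Functions on the boundary and their parametrizations -/

theorem periodic_deriv {E : Type*} [NormedAddCommGroup E] [NormedSpace ℝ E] {f : ℝ → E}
    (hf : Function.Periodic f 1) : Function.Periodic (deriv f) 1 := fun t => by
  have h : (fun x => f (x + 1)) = f := funext hf
  have h2 := deriv_comp_add_const (f := f) (a := (1 : ℝ)) (x := t)
  rw [h] at h2
  exact h2.symm

theorem periodic_fract {E : Type*} {f : ℝ → E} (hf : Function.Periodic f 1) (t : ℝ) :
    f (Int.fract t) = f t := by
  have := hf.sub_int_mul_eq (x := t) ⌊t⌋
  rwa [mul_one] at this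

theorem exists_bound_of_periodic {E : Type*} [NormedAddCommGroup E] {f : ℝ → E}
    (hf : Function.Periodic f 1) (hc : Continuous f) : ∃ M, 0 ≤ M ∧ ∀ t, ‖f t‖ ≤ M := by
  obtain ⟨M, hM⟩ := (hf.isBounded_of_continuous one_ne_zero hc).exists_norm_le
  exact ⟨M, (norm_nonneg _).trans (hM _ (mem_range_self 0)), fun t => hM _ (mem_range_self t)⟩

namespace IsSmoothDomain

variable (hΩ : IsSmoothDomain Ω γ)
include hΩ

theorem continuous (i : Fin n) : Continuous (γ i) := (hΩ.contDiff i).continuous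

theorem hasDerivAt (i : Fin n) (t : ℝ) : HasDerivAt (γ i) (deriv (γ i) t) t :=
  ((hΩ.contDiff i).differentiable (by simp) t).hasDerivAt

theorem contDiff_deriv (i : Fin n) : ContDiff ℝ ∞ (deriv (γ i)) :=
  (contDiff_infty_iff_deriv.1 (hΩ.contDiff i)).2

theorem continuous_deriv (i : Fin n) : Continuous (deriv (γ i)) :=
  (hΩ.contDiff_deriv i).continuous

theorem mem_frontier (i : Fin n) (t : ℝ) : γ i t ∈ frontier Ω := by
  rw [hΩ.frontier_eq]
  exact mem_iUnion.2 ⟨i, t, rfl⟩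

theorem exists_param {z : ℂ} (hz : z ∈ frontier Ω) : ∃ i t, γ i t = z := by
  rw [hΩ.frontier_eq] at hz
  obtain ⟨i, t, h⟩ := mem_iUnion.1 hz
  exact ⟨i, t, h⟩

/-- By periodicity the parameter of a boundary point can be chosen at most half a period from a
given `s`, where the chord-arc estimate applies. -/
theorem exists_param_near {z : ℂ} (hz : z ∈ frontier Ω) (s : ℝ) :
    ∃ i t, |t - s| ≤ 1 / 2 ∧ γ i t = z := by
  obtain ⟨i, t, h⟩ := hΩ.exists_param hz
  refine ⟨i, t - round (t - s), ?_, ?_⟩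
  · have := abs_sub_round (t - s)
    rwa [sub_right_comm]
  · have := (hΩ.periodic i).sub_int_mul_eq (x := t) (round (t - s))
    rw [mul_one] at this
    rw [this, h]

theorem fract_eq {i j : Fin n} {s t : ℝ} (h : γ i s = γ j t) :
    i = j ∧ Int.fract s = Int.fract t := by
  refine hΩ.simple i j _ ⟨Int.fract_nonneg s, Int.fract_lt_one s⟩ _
    ⟨Int.fract_nonneg t, Int.fract_lt_one t⟩ ?_
  rw [periodic_fract (hΩ.periodic i), periodic_fract (hΩ.periodic j), h]

/-- A family of periodic functions of the parameters descends to a function on the boundary. -/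
theorem exists_boundary_function {E : Type*} [Inhabited E] (f : Fin n → ℝ → E)
    (hf : ∀ i, Function.Periodic (f i) 1) : ∃ v : ℂ → E, ∀ i t, v (γ i t) = f i t := by
  classical
  refine ⟨fun z => if h : ∃ p : Fin n × ℝ, γ p.1 p.2 = z then f h.choose.1 h.choose.2
    else default, fun i t => ?_⟩
  have hex : ∃ p : Fin n × ℝ, γ p.1 p.2 = γ i t := ⟨(i, t), rfl⟩
  simp only [dif_pos hex]
  obtain ⟨h1, h2⟩ := hΩ.fract_eq hex.choose_spec
  rw [← periodic_fract (hf _), h2, h1, periodic_fract (hf i)]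

/-! ### Chord-arc estimates -/

/-- On a single curve, chords are comparable to parameter differences: the difference quotient,
written as the mean of `γ'` over the arc, is continuous and does not vanish. -/
theorem exists_chord_same (i : Fin n) :
    ∃ c > 0, ∀ s t : ℝ, |t - s| ≤ 1 / 2 → c * |t - s| ≤ ‖γ i t - γ i s‖ := by
  set D : ℝ × ℝ → ℂ := fun p => ∫ θ in (0 : ℝ)..1, deriv (γ i) (p.1 + θ • p.2) with hD
  have hDc : Continuous D := by
    refine intervalIntegral.continuous_parametric_intervalIntegral_of_continuous' ?_ 0 1
    have := hΩ.continuous_deriv i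
    fun_prop
  have hDeq : ∀ s h : ℝ, h • D (s, h) = γ i (s + h) - γ i s := fun s h =>
    intervalIntegral.integral_unitInterval_deriv_eq_sub
      (f := γ i) (f' := deriv (γ i)) (z₀ := s) (z₁ := h)
      ((hΩ.continuous_deriv i).comp (by fun_prop)).continuousOn
      fun t _ => hΩ.hasDerivAt i _
  have hK : IsCompact (Icc (0 : ℝ) 1 ×ˢ Icc (-(1 / 2) : ℝ) (1 / 2)) :=
    isCompact_Icc.prod isCompact_Icc
  obtain ⟨p, hp, hmin⟩ := hK.exists_isMinOn ⟨(0, 0), by constructor <;> simp⟩ hDc.norm.continuousOn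
  refine ⟨‖D p‖, ?_, ?_⟩
  · rw [gt_iff_lt, norm_pos_iff]
    intro h0
    obtain ⟨s, h⟩ := p
    by_cases hh : h = 0
    · subst hh
      simp only [hD, smul_zero, add_zero, intervalIntegral.integral_const, sub_zero,
        one_smul] at h0
      exact hΩ.deriv_ne_zero i s h0
    -- a nontrivial chord of length zero would make `h` a period, but `|h| ≤ 1 / 2`
    · have h1 := hDeq s h
      rw [h0, smul_zero] at h1
      have h2 := (hΩ.fract_eq (sub_eq_zero.1 h1.symm)).2
      obtain ⟨k, hk⟩ := Int.fract_eq_fract.1 h2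
      have hk' : h = k := by linarith
      have h3 := hp.2
      simp only [mem_Icc, hk'] at h3
      have h4 : k < 1 := by exact_mod_cast (lt_of_le_of_lt h3.2 (by norm_num) : (k : ℝ) < 1)
      have h5 : -1 < k := by
        exact_mod_cast (lt_of_lt_of_le (by norm_num) h3.1 : (-1 : ℝ) < (k : ℝ))
      have : k = 0 := by omega
      exact hh (by rw [hk', this, Int.cast_zero])
  · intro s t hst
    have h1 : ‖D p‖ ≤ ‖D (Int.fract s, t - s)‖ :=
      hmin (show (Int.fract s, t - s) ∈ _ from
        ⟨⟨Int.fract_nonneg s, (Int.fract_lt_one s).le⟩, abs_le.1 hst⟩)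
    have h2 := hDeq (Int.fract s) (t - s)
    have h3 : γ i (Int.fract s + (t - s)) = γ i t := by
      have := (hΩ.periodic i).sub_int_mul_eq (x := t) ⌊s⌋
      rw [mul_one] at this
      rw [← this, Int.fract]
      congr 1; ring
    rw [h3, periodic_fract (hΩ.periodic i)] at h2
    rw [← h2, norm_smul, Real.norm_eq_abs, mul_comm]
    gcongr

theorem exists_chord_ne {i j : Fin n} (hij : i ≠ j) :
    ∃ c > 0, ∀ s t : ℝ, c ≤ ‖γ i s - γ j t‖ := by
  have hc : Continuous fun p : ℝ × ℝ => ‖γ i p.1 - γ j p.2‖ :=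
    (((hΩ.continuous i).comp continuous_fst).sub ((hΩ.continuous j).comp continuous_snd)).norm
  have hK : IsCompact (Icc (0 : ℝ) 1 ×ˢ Icc (0 : ℝ) 1) := isCompact_Icc.prod isCompact_Icc
  obtain ⟨p, -, hmin⟩ := hK.exists_isMinOn ⟨(0, 0), by constructor <;> simp⟩ hc.continuousOn
  refine ⟨‖γ i p.1 - γ j p.2‖, norm_pos_iff.2 fun h =>
    hij (hΩ.fract_eq (sub_eq_zero.1 h)).1, fun s t => ?_⟩
  have := hmin (show (Int.fract s, Int.fract t) ∈ _ from
    ⟨⟨Int.fract_nonneg s, (Int.fract_lt_one s).le⟩, ⟨Int.fract_nonneg t, (Int.fract_lt_one t).le⟩⟩)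
  simpa only [mem_ofPred_eq, periodic_fract (hΩ.periodic _)] using this

/-- The chord-arc estimate, with a single constant for all pairs of boundary curves. -/
theorem exists_chord :
    ∃ c > 0, (∀ i (s t : ℝ), |t - s| ≤ 1 / 2 → c * |t - s| ≤ ‖γ i t - γ i s‖) ∧
      ∀ i j (s t : ℝ), i ≠ j → c ≤ ‖γ i s - γ j t‖ := by
  have h1 : ∀ i, ∀ᶠ c in 𝓝[>] (0 : ℝ), ∀ s t : ℝ, |t - s| ≤ 1 / 2 →
      c * |t - s| ≤ ‖γ i t - γ i s‖ := fun i => by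
    obtain ⟨c, hc, h⟩ := hΩ.exists_chord_same i
    filter_upwards [Ioo_mem_nhdsGT hc] with c' hc' s t hst
    exact (mul_le_mul_of_nonneg_right hc'.2.le (abs_nonneg _)).trans (h s t hst)
  have h2 : ∀ i j, ∀ᶠ c in 𝓝[>] (0 : ℝ), ∀ s t : ℝ, i ≠ j → c ≤ ‖γ i s - γ j t‖ := fun i j => by
    by_cases hij : i = j
    · exact Eventually.of_forall fun c s t h => absurd hij h
    obtain ⟨c, hc, h⟩ := hΩ.exists_chord_ne hij
    filter_upwards [Ioo_mem_nhdsGT hc] with c' hc' s t _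
    exact hc'.2.le.trans (h s t)
  obtain ⟨c, h, h', hc⟩ := ((eventually_all.2 h1).and ((eventually_all.2 fun i =>
    eventually_all.2 (h2 i)).and self_mem_nhdsWithin)).exists
  exact ⟨c, hc, h, fun i j s t => h' i j s t⟩

end IsSmoothDomain

theorem BdrySmooth.periodic {E : Type*} [NormedAddCommGroup E] [NormedSpace ℝ E]
    (hΩ : IsSmoothDomain Ω γ) (u : ℂ → E) (i : Fin n) :
    Function.Periodic (fun t => u (γ i t)) 1 := fun t => by
  simp only [hΩ.periodic i t]

/-- Smooth functions on the boundary are Lipschitz for the distance of the plane. -/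
theorem BdrySmooth.exists_lipschitz {E : Type*} [NormedAddCommGroup E] [NormedSpace ℝ E]
    (hΩ : IsSmoothDomain Ω γ) {u : ℂ → E} (hu : BdrySmooth γ u) :
    ∃ L, 0 ≤ L ∧ ∀ z ∈ frontier Ω, ∀ w ∈ frontier Ω, ‖u z - u w‖ ≤ L * ‖z - w‖ := by
  obtain ⟨c, hc, h1, h2⟩ := hΩ.exists_chord
  obtain ⟨B, hB⟩ :=
    (isCompact_frontier hΩ).exists_bound_of_continuousOn (continuousOn_of_bdrySmooth hΩ hu)
  have hM : ∀ i, ∀ᶠ M in atTop, ∀ t, ‖deriv (fun t => u (γ i t)) t‖ ≤ M := fun i => by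
    obtain ⟨M, -, hM⟩ := exists_bound_of_periodic (periodic_deriv (BdrySmooth.periodic hΩ u i))
      ((hu i).continuous_deriv (by simp))
    filter_upwards [eventually_ge_atTop M] with M' hM' t
    exact (hM t).trans hM'
  obtain ⟨M, hM, hM0, hMB⟩ := ((eventually_all.2 hM).and
    ((eventually_ge_atTop (0 : ℝ)).and (eventually_ge_atTop (2 * B)))).exists
  refine ⟨M / c, by positivity, fun z hz w hw => ?_⟩
  obtain ⟨j, s, rfl⟩ := hΩ.exists_param hw
  obtain ⟨i, t, hts, rfl⟩ := hΩ.exists_param_near hz s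
  rw [div_mul_eq_mul_div, le_div_iff₀ hc]
  by_cases hij : i = j
  · subst hij
    have h3 : ‖u (γ i t) - u (γ i s)‖ ≤ M * ‖t - s‖ :=
      Convex.norm_image_sub_le_of_norm_deriv_le (f := fun t => u (γ i t)) (s := univ)
        (fun x _ => (hu i).differentiable (by simp) x) (fun x _ => hM i x) convex_univ
        (mem_univ _) (mem_univ _)
    calc _ ≤ M * ‖t - s‖ * c := by gcongr
      _ = M * (c * |t - s|) := by rw [Real.norm_eq_abs]; ring
      _ ≤ _ := by gcongr; exact h1 i s t hts
  · have h3 : ‖u (γ i t) - u (γ j s)‖ ≤ M :=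
      (norm_sub_le _ _).trans (by linarith [hB _ hz, hB _ hw])
    exact mul_le_mul h3 (h2 i j t s hij) hc.le hM0

/-! ### Collar coordinates -/

/-- The collar map `t + i s ↦ γ(t) + s i γ'(t)` of a curve: it straightens the curve to the real
axis, and the left side of the curve to the upper half plane. -/
def collar (γ : ℝ → ℂ) (w : ℂ) : ℂ := γ w.re + w.im * (Complex.I * deriv γ w.re)

theorem collar_ofReal (γ : ℝ → ℂ) (t : ℝ) : collar γ t = γ t := by simp [collar]

/-- Multiplication by a nonzero complex number as a real linear equivalence. -/
def mulEquiv (a : ℂ) (ha : a ≠ 0) : ℂ ≃L[ℝ] ℂ :=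
  (ContinuousLinearEquiv.unitsEquivAut ℂ (Units.mk0 a ha)).restrictScalars ℝ

theorem mulEquiv_apply (a : ℂ) (ha : a ≠ 0) (z : ℂ) : mulEquiv a ha z = z * a := rfl

namespace IsSmoothDomain

variable (hΩ : IsSmoothDomain Ω γ)
include hΩ

theorem contDiff_collar (i : Fin n) : ContDiff ℝ ∞ (collar (γ i)) := by
  have h1 := hΩ.contDiff i
  have h2 := hΩ.contDiff_deriv i
  have hre : ContDiff ℝ ∞ Complex.re := Complex.reCLM.contDiff
  have him : ContDiff ℝ ∞ (fun w : ℂ => (w.im : ℂ)) :=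
    Complex.ofRealCLM.contDiff.comp Complex.imCLM.contDiff
  exact (h1.comp hre).add (him.mul (contDiff_const.mul (h2.comp hre)))

theorem hasStrictFDerivAt_collar (i : Fin n) (t : ℝ) :
    HasStrictFDerivAt (collar (γ i))
      (mulEquiv (deriv (γ i) t) (hΩ.deriv_ne_zero i t) : ℂ →L[ℝ] ℂ) t := by
  have h0 : ContDiffAt ℝ ∞ (collar (γ i)) t := (hΩ.contDiff_collar i).contDiffAt
  refine h0.hasStrictFDerivAt' ?_ (by simp)
  have hre : HasFDerivAt Complex.re Complex.reCLM (t : ℂ) := Complex.reCLM.hasFDerivAt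
  have him : HasFDerivAt (fun w : ℂ => (w.im : ℂ)) (Complex.ofRealCLM.comp Complex.imCLM) (t : ℂ) :=
    (Complex.ofRealCLM.comp Complex.imCLM).hasFDerivAt
  have hd : HasDerivAt (deriv (γ i)) (deriv (deriv (γ i)) t) ((t : ℂ).re) :=
    ((hΩ.contDiff_deriv i).differentiable (by simp) _).hasDerivAt
  have h1 := (hΩ.hasDerivAt i (t : ℂ).re).hasFDerivAt.comp (t : ℂ) hre
  have h2 := him.mul ((hd.hasFDerivAt.comp (t : ℂ) hre).const_mul Complex.I)
  refine (h1.add h2).congr_fderiv ?_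
  ext z
  simp only [Complex.ofReal_re, Complex.ofReal_im, Function.comp_apply, Complex.ofReal_zero,
    zero_smul, zero_add, add_apply, ContinuousLinearMap.comp_apply,
    smul_apply, ContinuousLinearMap.toSpanSingleton_apply,
    Complex.reCLM_apply, Complex.imCLM_apply, Complex.ofRealCLM_apply, Complex.real_smul,
    smul_eq_mul, ContinuousLinearEquiv.coe_coe, mulEquiv_apply]
  conv_rhs => rw [← Complex.re_add_im z]
  ring

theorem collar_tendsto (i : Fin n) (t : ℝ) : Tendsto (collar (γ i)) (𝓝 (t : ℂ)) (𝓝 (γ i t)) := by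
  have := (hΩ.contDiff_collar i).continuous.tendsto (t : ℂ)
  rwa [collar_ofReal] at this

/-- Near a boundary point, the domain is exactly the left side of the boundary curve. -/
theorem collar_sides (i : Fin n) (t₀ : ℝ) :
    ∀ᶠ w in 𝓝 (t₀ : ℂ), (0 < w.im → collar (γ i) w ∈ Ω) ∧
      (w.im < 0 → collar (γ i) w ∉ closure Ω) := by
  obtain ⟨c, hc, h1, h2⟩ := hΩ.exists_chord
  -- on a small disc the collar map is injective, so only real points are mapped to the boundary
  obtain ⟨r, hr, hinj⟩ : ∃ r > 0, InjOn (collar (γ i)) (Metric.ball (t₀ : ℂ) r) := by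
    have hs := hΩ.hasStrictFDerivAt_collar i t₀
    obtain ⟨r, hr, h⟩ := Metric.eventually_nhds_iff_ball.1 hs.eventually_left_inverse
    refine ⟨r, hr, fun z hz w hw hzw => ?_⟩
    rw [← h z hz, ← h w hw, hzw]
  obtain ⟨r', hr', hdist⟩ := Metric.eventually_nhds_iff_ball.1
    (hΩ.collar_tendsto i t₀ (Metric.ball_mem_nhds _ (show 0 < c * min r 1 by positivity)))
  set ρ := min r r' with hρ
  have hρ0 : 0 < ρ := lt_min hr hr'
  -- other parts of the boundary stay away from `γ i t₀` by the chord-arc estimate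
  have hfr : ∀ w ∈ Metric.ball (t₀ : ℂ) ρ, collar (γ i) w ∈ frontier Ω → w.im = 0 := by
    intro w hw hwf
    obtain ⟨j, s, hs, hsw⟩ := hΩ.exists_param_near hwf t₀
    have hd : ‖γ j s - γ i t₀‖ < c * min r 1 := by
      rw [hsw]
      simpa [dist_eq_norm] using hdist w (Metric.ball_subset_ball (min_le_right _ _) hw)
    have hji : j = i := by
      by_contra hne
      have h3 : c * min r 1 ≤ c * 1 := by gcongr; exact min_le_right _ _
      linarith [h2 j i s t₀ hne]
    subst hji
    have hst : |s - t₀| < r := by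
      have := (h1 j t₀ s hs).trans_lt hd
      exact (lt_of_mul_lt_mul_left this hc.le).trans_le (min_le_left _ _)
    have hsr : (s : ℂ) ∈ Metric.ball (t₀ : ℂ) r := by
      rw [Metric.mem_ball, Complex.dist_eq, ← Complex.ofReal_sub, Complex.norm_real]
      exact hst
    have : w = s := hinj (Metric.ball_subset_ball (min_le_left _ _) hw) hsr
      (by rw [collar_ofReal, hsw])
    rw [this, Complex.ofReal_im]
  have hcv : Tendsto (fun r : ℝ => (t₀ : ℂ) + r * Complex.I) (𝓝 0) (𝓝 (t₀ : ℂ)) := by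
    have : Continuous (fun r : ℝ => (t₀ : ℂ) + r * Complex.I) := by fun_prop
    simpa using this.tendsto 0
  have hev := hcv.eventually (Metric.ball_mem_nhds _ hρ0)
  have hcol : ∀ r : ℝ, collar (γ i) (t₀ + r * Complex.I)
      = γ i t₀ + r * (Complex.I * deriv (γ i) t₀) := fun r => by simp [collar]
  -- each half disc has a connected image off the boundary, so one point decides on which side it is
  have hside : ∀ κ : ℝ, IsPreconnected (collar (γ i) ''
      (Metric.ball (t₀ : ℂ) ρ ∩ {w | 0 < κ * w.im})) := fun κ => by
    refine IsPreconnected.image (Convex.isPreconnected ?_) _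
      (hΩ.contDiff_collar i).continuous.continuousOn
    exact (convex_ball _ _).inter
      ((convex_Ioi (0 : ℝ)).linear_preimage (κ • Complex.imCLM.toLinearMap))
  have hsub : ∀ κ : ℝ, collar (γ i) '' (Metric.ball (t₀ : ℂ) ρ ∩ {w | 0 < κ * w.im}) ⊆
      Ω ∪ (closure Ω)ᶜ := by
    rintro κ _ ⟨w, ⟨hw, hκ⟩, rfl⟩
    by_contra hn
    rw [mem_union, not_or, notMem_compl_iff] at hn
    have := hfr w hw ⟨hn.2, by rw [hΩ.isOpen.interior_eq]; exact hn.1⟩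
    simp [this] at hκ
  have hdisj : Disjoint Ω (closure Ω)ᶜ := disjoint_compl_right_iff_subset.2 subset_closure
  filter_upwards [Metric.ball_mem_nhds _ hρ0] with w hw
  constructor
  · intro him
    obtain ⟨r, hrΩ, hrb, hr0⟩ := ((hΩ.left_mem i t₀).and ((hev.filter_mono nhdsWithin_le_nhds).and
      self_mem_nhdsWithin)).exists
    refine (hside 1).subset_left_of_subset_union hΩ.isOpen isClosed_closure.isOpen_compl hdisj
      (hsub 1) ⟨_, ⟨t₀ + r * Complex.I, ⟨hrb, ?_⟩, rfl⟩, ?_⟩ ⟨w, ⟨hw, by simpa using him⟩, rfl⟩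
    · simpa using hr0
    · rw [hcol]; exact hrΩ
  · intro him
    obtain ⟨r, hrΩ, hrb, hr0⟩ := ((hΩ.right_notMem i t₀).and
      ((hev.filter_mono nhdsWithin_le_nhds).and self_mem_nhdsWithin)).exists
    have hmem : (t₀ + r * Complex.I : ℂ) ∈
        Metric.ball (t₀ : ℂ) ρ ∩ {w | 0 < (-1 : ℝ) * w.im} := ⟨hrb, by simpa using hr0⟩
    refine (hside (-1)).subset_right_of_subset_union hΩ.isOpen isClosed_closure.isOpen_compl hdisj
      (hsub (-1)) ⟨_, ⟨_, hmem, rfl⟩, ?_⟩ ⟨w, ⟨hw, by simpa using him⟩, rfl⟩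
    refine ((hsub (-1)) ⟨_, hmem, rfl⟩).resolve_left ?_
    rw [hcol]; exact hrΩ

/-- The half disc description of `Ω`, in the form used by `hasDerivWithinAt_of_collar`. -/
theorem collar_left (i : Fin n) (t₀ : ℝ) :
    (∀ᶠ w in 𝓝 (t₀ : ℂ), 0 < 1 * w.im → collar (γ i) w ∈ Ω) ∧
      ∀ᶠ w in 𝓝 (t₀ : ℂ), collar (γ i) w ∈ closure Ω → 0 ≤ 1 * w.im := by
  have h := hΩ.collar_sides i t₀
  refine ⟨h.mono fun w hw h0 => hw.1 (by simpa using h0), h.mono fun w hw hc => ?_⟩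
  by_contra! h0
  exact hw.2 (by simpa using h0) hc

theorem collar_right (i : Fin n) (t₀ : ℝ) :
    (∀ᶠ w in 𝓝 (t₀ : ℂ), 0 < (-1) * w.im → collar (γ i) w ∈ (closure Ω)ᶜ) ∧
      ∀ᶠ w in 𝓝 (t₀ : ℂ), collar (γ i) w ∈ closure (closure Ω)ᶜ → 0 ≤ (-1) * w.im := by
  have h := hΩ.collar_sides i t₀
  refine ⟨h.mono fun w hw h0 => hw.2 (by simpa using h0), h.mono fun w hw hc => ?_⟩
  by_contra! h0
  rw [closure_compl] at hc
  exact hc (hΩ.isOpen.subset_interior_iff.2 subset_closure (hw.1 (by simpa using h0)))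

/-- If the derivative of `f` on a side `W` of the boundary extends continuously to the boundary,
then so does the differentiability of `f`. In collar coordinates `W` is a half disc, which is
convex, so the mean value inequality applies. The sign of `κ` selects the side: `W` is `Ω` for
`κ = 1` and the exterior for `κ = -1`. -/
theorem hasDerivWithinAt_of_collar {W : Set ℂ} {f g : ℂ → ℂ} (i : Fin n) (t₀ κ : ℝ)
    (hκ : κ ≠ 0) (h1 : ∀ᶠ w in 𝓝 (t₀ : ℂ), 0 < κ * w.im → collar (γ i) w ∈ W)
    (h2 : ∀ᶠ w in 𝓝 (t₀ : ℂ), collar (γ i) w ∈ closure W → 0 ≤ κ * w.im)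
    (hf : ContinuousOn f (closure W)) (hg : ContinuousOn g (closure W))
    (hfg : ∀ z ∈ W, HasDerivAt f (g z) z) :
    HasDerivWithinAt f (g (γ i t₀)) (closure W) (γ i t₀) := by
  set Φ := collar (γ i) with hΦ
  set a := deriv (γ i) t₀ with ha
  have ha0 : a ≠ 0 := hΩ.deriv_ne_zero i t₀
  have hΦc : Continuous Φ := (hΩ.contDiff_collar i).continuous
  have hs := hΩ.hasStrictFDerivAt_collar i t₀
  obtain ⟨r, hr, hrW⟩ := Metric.eventually_nhds_iff_ball.1 h1
  set U := Metric.ball (t₀ : ℂ) r ∩ {w | 0 < κ * w.im} with hU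
  have hUo : IsOpen U := Metric.isOpen_ball.inter
    (isOpen_lt continuous_const (continuous_const.mul Complex.continuous_im))
  have hUW : MapsTo Φ U W := fun w hw => hrW w hw.1 hw.2
  have hUcl : MapsTo Φ (closure U) (closure W) := hUW.closure hΦc
  have hUc : Convex ℝ U := (convex_ball _ _).inter
      ((convex_Ioi (0 : ℝ)).linear_preimage (κ • Complex.imCLM.toLinearMap))
  -- points of the closed half disc lie in the closure of the open one
  have hcl : ∀ w ∈ Metric.ball (t₀ : ℂ) r, 0 ≤ κ * w.im → w ∈ closure U := by
    intro w hw hw0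
    have hcv : Tendsto (fun ε : ℝ => w + (ε * κ : ℝ) * Complex.I) (𝓝[>] 0) (𝓝 w) := by
      have : Continuous (fun ε : ℝ => w + (ε * κ : ℝ) * Complex.I) := by fun_prop
      simpa using (this.tendsto 0).mono_left nhdsWithin_le_nhds
    refine mem_closure_of_tendsto hcv ?_
    filter_upwards [hcv (Metric.isOpen_ball.mem_nhds hw), self_mem_nhdsWithin] with ε hε hε0
    refine ⟨hε, ?_⟩
    have : 0 < ε * (κ * κ) := mul_pos hε0 (mul_self_pos.2 hκ)
    simp only [mem_ofPred_eq, Complex.add_im, Complex.mul_im, Complex.ofReal_re, Complex.I_im,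
      Complex.ofReal_im, Complex.I_re]
    nlinarith
  have ht₀ : (t₀ : ℂ) ∈ closure U := hcl _ (Metric.mem_ball_self hr) (by simp)
  have hd : ∀ w ∈ U, HasFDerivAt (f ∘ Φ) (g (Φ w) • fderiv ℝ Φ w) w := fun w hw =>
    (hfg _ (hUW hw)).complexToReal_fderiv.comp w
      ((hΩ.contDiff_collar i).differentiable (by simp) w).hasFDerivAt
  have hlim : Tendsto (fun w => fderiv ℝ (f ∘ Φ) w) (𝓝[U] (t₀ : ℂ))
      (𝓝 (g (γ i t₀) • (mulEquiv a ha0 : ℂ →L[ℝ] ℂ))) := by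
    have hg' : Tendsto (fun w => g (Φ w)) (𝓝[U] (t₀ : ℂ)) (𝓝 (g (γ i t₀))) := by
      have h3 : ContinuousWithinAt (g ∘ Φ) (closure U) t₀ :=
        (hg.comp hΦc.continuousOn hUcl) _ ht₀
      have h4 := h3.tendsto.mono_left (nhdsWithin_mono _ subset_closure)
      rw [Function.comp_apply, hΦ, collar_ofReal] at h4
      exact h4
    have hΦ' : Tendsto (fun w => fderiv ℝ Φ w) (𝓝[U] (t₀ : ℂ))
        (𝓝 (mulEquiv a ha0 : ℂ →L[ℝ] ℂ)) := by
      have h3 := ((hΩ.contDiff_collar i).continuous_fderiv (by simp)).tendsto (t₀ : ℂ)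
      rw [hs.hasFDerivAt.fderiv] at h3
      exact h3.mono_left nhdsWithin_le_nhds
    refine (hg'.smul hΦ').congr' ?_
    filter_upwards [self_mem_nhdsWithin] with w hw using (hd w hw).fderiv.symm
  have hmain : HasFDerivWithinAt (f ∘ Φ) (g (γ i t₀) • (mulEquiv a ha0 : ℂ →L[ℝ] ℂ))
      (closure U) t₀ := by
    refine hasFDerivWithinAt_closure_of_tendsto_fderiv
      (fun w hw => (hd w hw).differentiableAt.differentiableWithinAt) hUc hUo (fun w hw => ?_) hlim
    exact ((hf.comp hΦc.continuousOn hUcl) w hw).mono subset_closure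
  -- back to the plane through the local inverse of the collar map
  have hΨ := hs.to_localInverse
  set Ψ := hs.localInverse (collar (γ i)) _ _ with hΨdef
  have hΨ0 : Ψ (γ i t₀) = t₀ := by
    have := hs.localInverse_apply_image
    rwa [collar_ofReal] at this
  rw [collar_ofReal] at hΨ
  have hΨt : Tendsto Ψ (𝓝 (γ i t₀)) (𝓝 (t₀ : ℂ)) := by
    have := hΨ.hasFDerivAt.continuousAt.tendsto
    rwa [hΨ0] at this
  have hright : ∀ᶠ z in 𝓝 (γ i t₀), Φ (Ψ z) = z := by
    have := hs.eventually_right_inverse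
    rwa [collar_ofReal] at this
  have hV := hright.and ((hΨt.eventually (Metric.ball_mem_nhds _ hr)).and (hΨt.eventually h2))
  have hmaps : MapsTo Ψ (closure W ∩ {z | Φ (Ψ z) = z ∧ Ψ z ∈ Metric.ball (t₀ : ℂ) r ∧
      (Φ (Ψ z) ∈ closure W → 0 ≤ κ * (Ψ z).im)}) (closure U) := by
    rintro z ⟨hzW, hz1, hz2, hz3⟩
    exact hcl _ hz2 (hz3 (by rwa [hz1]))
  rw [← hasDerivWithinAt_inter hV]
  rw [← hΨ0] at hmain
  have hfin := hmain.comp (γ i t₀) hΨ.hasFDerivAt.hasFDerivWithinAt hmaps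
  have hcongr : HasFDerivWithinAt f _ _ (γ i t₀) := hfin.congr_of_eventuallyEq
    (by filter_upwards [self_mem_nhdsWithin] with z hz; simp [hz.2.1])
    (by simp [hΨ0, hΦ, collar_ofReal])
  refine hasDerivWithinAt_iff_hasFDerivWithinAt.2 (.of_restrictScalars ℝ hcongr ?_)
  ext z
  simp [← ha, mul_comm]

theorem hasDerivWithinAt_closure {f g : ℂ → ℂ} (hf : ContinuousOn f (closure Ω))
    (hg : ContinuousOn g (closure Ω)) (hfg : ∀ z ∈ Ω, HasDerivAt f (g z) z) (i : Fin n) (t : ℝ) :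
    HasDerivWithinAt f (g (γ i t)) (closure Ω) (γ i t) :=
  hΩ.hasDerivWithinAt_of_collar i t 1 one_ne_zero (hΩ.collar_left i t).1 (hΩ.collar_left i t).2
    hf hg hfg

/-- The boundary curves are removable for continuous functions whose derivative off the curves
extends continuously. -/
theorem hasDerivAt_of_off_frontier {f g : ℂ → ℂ} (hf : Continuous f) (hg : Continuous g)
    (hfg : ∀ z ∉ frontier Ω, HasDerivAt f (g z) z) (z : ℂ) : HasDerivAt f (g z) z := by
  by_cases hz : z ∈ frontier Ω
  · obtain ⟨i, t, rfl⟩ := hΩ.exists_param hz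
    have h1 := hΩ.hasDerivWithinAt_closure hf.continuousOn hg.continuousOn
      (fun z hz => hfg z fun h => (hΩ.isOpen.inter_frontier_eq ▸ ⟨hz, h⟩ : z ∈ (∅ : Set ℂ))) i t
    have h2 := hΩ.hasDerivWithinAt_of_collar (W := (closure Ω)ᶜ) i t (-1) (by norm_num)
      (hΩ.collar_right i t).1 (hΩ.collar_right i t).2 hf.continuousOn hg.continuousOn
      (fun z hz => hfg z fun h => hz h.1)
    have h3 := h1.union h2
    have h4 : closure Ω ∪ closure (closure Ω)ᶜ = univ :=
      eq_univ_of_forall fun z => (em (z ∈ closure Ω)).imp id fun h => subset_closure h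
    rwa [h4, hasDerivWithinAt_univ] at h3
  · exact hfg z hz

/-- The chain rule along the boundary, where `g` plays the part of the complex derivative of `f`. -/
theorem hasDerivAt_comp {f g : ℂ → ℂ} (hf : ContinuousOn f (closure Ω))
    (hg : ContinuousOn g (closure Ω)) (hfg : ∀ z ∈ Ω, HasDerivAt f (g z) z) (i : Fin n) (t : ℝ) :
    HasDerivAt (fun t => f (γ i t)) (g (γ i t) * deriv (γ i) t) t := by
  have h1 := (hΩ.hasDerivWithinAt_closure hf hg hfg i t).scomp t
    (hΩ.hasDerivAt i t).hasDerivWithinAt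
    (fun s _ => frontier_subset_closure (hΩ.mem_frontier i s) : MapsTo (γ i) univ (closure Ω))
  rw [hasDerivWithinAt_univ, smul_eq_mul, mul_comm] at h1
  exact h1

/-- A function on the closure of `Ω` with successive complex derivatives continuous up to the
boundary has smooth boundary values. -/
theorem bdrySmooth_of_derivatives (H : ℕ → ℂ → ℂ) (hc : ∀ k, ContinuousOn (H k) (closure Ω))
    (hd : ∀ k, ∀ z ∈ Ω, HasDerivAt (H k) (H (k + 1) z) z) (k : ℕ) : BdrySmooth γ (H k) := by
  intro i
  rw [contDiff_infty]
  intro m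
  induction m generalizing k with
  | zero =>
    rw [Nat.cast_zero, contDiff_zero]
    exact continuous_iff_continuousAt.2 fun t =>
      (hΩ.hasDerivAt_comp (hc k) (hc (k + 1)) (hd k) i t).continuousAt
  | succ m ih =>
    have h1 : ∀ t, HasDerivAt (fun t => H k (γ i t)) (H (k + 1) (γ i t) * deriv (γ i) t) t :=
      hΩ.hasDerivAt_comp (hc k) (hc (k + 1)) (hd k) i
    rw [Nat.cast_add, Nat.cast_one, contDiff_succ_iff_deriv]
    refine ⟨fun t => (h1 t).differentiableAt, by simp, ?_⟩
    rw [show deriv (fun t => H k (γ i t)) = fun t => H (k + 1) (γ i t) * deriv (γ i) t from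
      funext fun t => (h1 t).deriv]
    exact (ih (k + 1)).mul (contDiff_infty.1 (hΩ.contDiff_deriv i) m)

end IsSmoothDomain

/-- The successive derivatives of a function in `A^∞(Ω)`, extended to the boundary. -/
theorem MemAInf.exists_derivatives (hΩ : IsOpen Ω) {h : ℂ → ℂ} (hh : MemAInf Ω h) :
    ∃ H : ℕ → ℂ → ℂ, H 0 = h ∧ (∀ k, ContinuousOn (H k) (closure Ω)) ∧
      ∀ k, ∀ z ∈ Ω, HasDerivAt (H k) (H (k + 1) z) z := by
  obtain ⟨hd, hc, hk⟩ := hh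
  choose g hgc hg using hk
  refine ⟨fun k => if k = 0 then h else g k, if_pos rfl, fun k => ?_, fun k z hz => ?_⟩
  · dsimp only
    split_ifs with h0
    · exact hc
    · exact hgc k
  · have hev : ∀ k, (if k = 0 then h else g k) =ᶠ[𝓝 z] iteratedDeriv k h := fun k => by
      filter_upwards [hΩ.mem_nhds hz] with w hw
      split_ifs with h0
      · rw [h0, iteratedDeriv_zero]
      · exact hg k hw
    have h1 : HasDerivAt (iteratedDeriv k h) (iteratedDeriv (k + 1) h z) z := by
      rw [iteratedDeriv_succ]
      refine DifferentiableAt.hasDerivAt ?_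
      rw [iteratedDeriv_eq_iterate]
      exact ((hd.analyticAt (hΩ.mem_nhds hz)).iterated_deriv k).differentiableAt
    rw [← (hev (k + 1)).eq_of_nhds] at h1
    exact h1.congr_of_eventuallyEq (hev k)

/-- Functions in `A^∞(Ω)` have smooth boundary values. -/
theorem MemAInf.bdrySmooth (hΩ : IsSmoothDomain Ω γ) {h : ℂ → ℂ} (hh : MemAInf Ω h) :
    BdrySmooth γ h := by
  obtain ⟨H, rfl, hc, hd⟩ := hh.exists_derivatives hΩ.isOpen
  exact hΩ.bdrySmooth_of_derivatives H hc hd 0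

/-! ### Integration with respect to arc length -/

theorem contDiff_div {f g : ℝ → ℂ} (hf : ContDiff ℝ ∞ f) (hg : ContDiff ℝ ∞ g)
    (h0 : ∀ t, g t ≠ 0) : ContDiff ℝ ∞ fun t => f t / g t := by
  simp only [div_eq_mul_inv]
  exact hf.mul (hg.inv h0)

theorem norm_unitTangent (hΩ : IsSmoothDomain Ω γ) {z : ℂ} (hz : z ∈ frontier Ω) :
    ‖unitTangent γ z‖ = 1 := by
  obtain ⟨i, t, rfl⟩ := hΩ.exists_param hz
  rw [unitTangent_apply hΩ, norm_div, Complex.norm_real, norm_norm,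
    div_self (norm_ne_zero_iff.2 (hΩ.deriv_ne_zero i t))]

theorem bdrySmooth_unitTangent (hΩ : IsSmoothDomain Ω γ) : BdrySmooth γ (unitTangent γ) := by
  intro i
  simp only [unitTangent_apply hΩ]
  have h1 : ContDiff ℝ ∞ fun t => (‖deriv (γ i) t‖ : ℂ) :=
    Complex.ofRealCLM.contDiff.comp ((hΩ.contDiff_deriv i).norm ℝ (hΩ.deriv_ne_zero i))
  exact contDiff_div (hΩ.contDiff_deriv i) h1 fun t => by
    simpa using hΩ.deriv_ne_zero i t

theorem ContinuousOn.aestronglyMeasurable_arcLength (hΩ : IsSmoothDomain Ω γ) {E : Type*}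
    [NormedAddCommGroup E] {u : ℂ → E} (hu : ContinuousOn u (frontier Ω)) :
    AEStronglyMeasurable u (arcLength γ) := by
  have h := hu.aestronglyMeasurable_of_isCompact (μ := arcLength γ) (isCompact_frontier hΩ)
    isClosed_frontier.measurableSet
  rwa [Measure.restrict_eq_self_of_ae_mem (ae_mem_frontier hΩ)] at h

theorem ContinuousOn.integrable_arcLength (hΩ : IsSmoothDomain Ω γ) {E : Type*}
    [NormedAddCommGroup E] {u : ℂ → E} (hu : ContinuousOn u (frontier Ω)) :
    Integrable u (arcLength γ) := by
  have := isFiniteMeasure_arcLength hΩ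
  obtain ⟨B, hB⟩ := (isCompact_frontier hΩ).exists_bound_of_continuousOn hu
  exact .of_bound (ContinuousOn.aestronglyMeasurable_arcLength hΩ hu) B
    ((ae_mem_frontier hΩ).mono hB)

theorem integral_arcLength (hΩ : IsSmoothDomain Ω γ) {f : ℂ → ℂ}
    (hf : Integrable f (arcLength γ)) :
    ∫ z, f z ∂(arcLength γ) = ∑ i, ∫ t in (0 : ℝ)..1, ‖deriv (γ i) t‖ • f (γ i t) := by
  set σ : Fin n → Measure ℂ := fun i => ((volume.restrict (Ico (0 : ℝ) 1)).withDensity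
    (fun t => ENNReal.ofReal ‖deriv (γ i) t‖)).map (γ i) with hσ
  have hle : ∀ i, σ i ≤ arcLength γ := fun i => by
    rw [Measure.le_iff]
    intro s _
    rw [arcLength, Measure.finsetSum_apply]
    exact Finset.single_le_sum (f := fun i => σ i s) (fun _ _ => zero_le) (Finset.mem_univ i)
  have hfi : ∀ i, Integrable f (σ i) := fun i => hf.mono_measure (hle i)
  rw [arcLength, integral_finsetSum_measure fun i _ => hfi i]
  refine Finset.sum_congr rfl fun i _ => ?_
  rw [integral_map (hΩ.continuous i).measurable.aemeasurable (hfi i).aestronglyMeasurable,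
    integral_withDensity_eq_integral_toReal_smul
      (hΩ.continuous_deriv i).norm.measurable.ennreal_ofReal (by simp),
    intervalIntegral.integral_of_le zero_le_one, integral_Ico_eq_integral_Ioc]
  simp only [ENNReal.toReal_ofReal (norm_nonneg _)]

theorem arcLength_singleton (hΩ : IsSmoothDomain Ω γ) (z : ℂ) : arcLength γ {z} = 0 := by
  rw [arcLength, Measure.finsetSum_apply]
  refine Finset.sum_eq_zero fun i _ => ?_
  rw [Measure.map_apply (hΩ.continuous i).measurable (measurableSet_singleton z)]
  refine withDensity_absolutelyContinuous _ _ ?_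
  rw [Measure.restrict_apply ((hΩ.continuous i).measurable (measurableSet_singleton z))]
  refine Set.Subsingleton.measure_zero (fun s hs t ht => ?_) _
  exact (hΩ.simple i i s hs.2 t ht.2 (hs.1.trans ht.1.symm)).2

theorem ae_ne_arcLength (hΩ : IsSmoothDomain Ω γ) (z : ℂ) : ∀ᵐ ζ ∂(arcLength γ), ζ ≠ z := by
  rw [ae_iff]
  simpa using arcLength_singleton hΩ z

/-- The Cauchy integral as an integral for arc length: `dζ = T ds`. -/
theorem integral_mul_unitTangent (hΩ : IsSmoothDomain Ω γ) {f : ℂ → ℂ}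
    (hf : ContinuousOn f (frontier Ω)) :
    ∫ z, f z * unitTangent γ z ∂(arcLength γ) =
      ∑ i, ∫ t in (0 : ℝ)..1, f (γ i t) * deriv (γ i) t := by
  rw [integral_arcLength hΩ (ContinuousOn.integrable_arcLength hΩ
    (hf.fun_mul (continuousOn_of_bdrySmooth hΩ (bdrySmooth_unitTangent hΩ))))]
  refine Finset.sum_congr rfl fun i _ => intervalIntegral.integral_congr fun t _ => ?_
  have : (‖deriv (γ i) t‖ : ℂ) ≠ 0 := by simpa using hΩ.deriv_ne_zero i t
  simp only [unitTangent_apply hΩ, Complex.real_smul]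
  field_simp

theorem continuousOn_div_sub {u : ℂ → ℂ} (hu : ContinuousOn u (frontier Ω)) {z : ℂ}
    (hz : z ∉ frontier Ω) : ContinuousOn (fun ζ => u ζ / (ζ - z)) (frontier Ω) :=
  hu.div (by fun_prop) fun ζ hζ h => hz (sub_eq_zero.1 h ▸ hζ)

theorem cauchyIntegral_eq (hΩ : IsSmoothDomain Ω γ) {u : ℂ → ℂ}
    (hu : ContinuousOn u (frontier Ω)) {z : ℂ} (hz : z ∉ frontier Ω) :
    cauchyIntegral γ u z = (2 * Real.pi * Complex.I)⁻¹ *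
      ∫ ζ, u ζ / (ζ - z) * unitTangent γ ζ ∂(arcLength γ) := by
  rw [integral_mul_unitTangent hΩ (continuousOn_div_sub hu hz), cauchyIntegral]

/-! ### The Cauchy integral off the boundary -/

theorem exists_ball_of_notMem_frontier {z : ℂ} (hz : z ∉ frontier Ω) :
    ∃ ε > 0, ∀ ζ ∈ frontier Ω, ∀ w ∈ Metric.ball z ε, ε ≤ ‖ζ - w‖ := by
  obtain ⟨ε, hε, h⟩ := Metric.isOpen_iff.1 isClosed_frontier.isOpen_compl z hz
  refine ⟨ε / 2, by positivity, fun ζ hζ w hw => ?_⟩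
  have h1 : ε ≤ dist ζ z := by
    by_contra! h2
    exact h h2 hζ
  rw [← dist_eq_norm]
  linarith [dist_triangle ζ w z, Metric.mem_ball.1 hw]

theorem tendsto_cauchyIntegral_cocompact (hΩ : IsSmoothDomain Ω γ) {u : ℂ → ℂ}
    (hu : ContinuousOn u (frontier Ω)) :
    Tendsto (cauchyIntegral γ u) (cocompact ℂ) (𝓝 0) := by
  have := isFiniteMeasure_arcLength hΩ
  obtain ⟨B, hB⟩ := (isCompact_frontier hΩ).exists_bound_of_continuousOn hu
  obtain ⟨R, hR⟩ := (isCompact_frontier hΩ).isBounded.exists_norm_le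
  have hnorm := tendsto_norm_cocompact_atTop (E := ℂ)
  have hlim : Tendsto (fun z : ℂ => ‖(2 * Real.pi * Complex.I)⁻¹‖ *
      (B * (‖z‖ + -R)⁻¹ * (arcLength γ).real univ)) (cocompact ℂ) (𝓝 0) := by
    have := ((tendsto_inv_atTop_zero.comp (tendsto_atTop_add_const_right _ (-R) hnorm)).const_mul
      B).mul_const ((arcLength γ).real univ)
    simpa using this.const_mul ‖(2 * Real.pi * Complex.I)⁻¹‖
  refine squeeze_zero_norm' ?_ hlim
  filter_upwards [hnorm.eventually_gt_atTop R] with z hz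
  have hzf : z ∉ frontier Ω := fun h => absurd (hR z h) (not_le.2 hz)
  rw [cauchyIntegral_eq hΩ hu hzf, norm_mul]
  gcongr
  refine norm_integral_le_of_norm_le_const ?_
  filter_upwards [ae_mem_frontier hΩ] with ζ hζ
  rw [norm_mul, norm_unitTangent hΩ hζ, mul_one, norm_div, div_eq_mul_inv]
  have h1 := norm_sub_norm_le z ζ
  rw [norm_sub_rev] at h1
  gcongr
  · exact (norm_nonneg _).trans (hB ζ hζ)
  · exact hB ζ hζ
  · linarith
  · linarith [hR ζ hζ]

/-- Every smooth function on the boundary has a smooth complex tangential derivative `du / dζ`. -/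
theorem BdrySmooth.exists_tangential (hΩ : IsSmoothDomain Ω γ) {u : ℂ → ℂ} (hu : BdrySmooth γ u) :
    ∃ v, BdrySmooth γ v ∧
      ∀ i t, HasDerivAt (fun t => u (γ i t)) (v (γ i t) * deriv (γ i) t) t := by
  obtain ⟨v, hv⟩ := hΩ.exists_boundary_function
    (fun i t => deriv (fun t => u (γ i t)) t / deriv (γ i) t) fun i t => by
      simp only [periodic_deriv (BdrySmooth.periodic hΩ u i) t, periodic_deriv (hΩ.periodic i) t]
  refine ⟨v, fun i => ?_, fun i t => ?_⟩
  · simp only [hv]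
    exact contDiff_div (contDiff_infty_iff_deriv.1 (hu i)).2 (hΩ.contDiff_deriv i)
      (hΩ.deriv_ne_zero i)
  · rw [hv, div_mul_cancel₀ _ (hΩ.deriv_ne_zero i t)]
    exact ((hu i).differentiable (by simp) t).hasDerivAt

/-- Off the boundary the derivative of a Cauchy integral is the Cauchy integral of the tangential
derivative, by an integration by parts on the closed boundary curves. -/
theorem hasDerivAt_cauchyIntegral (hΩ : IsSmoothDomain Ω γ) {u v : ℂ → ℂ} (hu : BdrySmooth γ u)
    (hv : BdrySmooth γ v)
    (huv : ∀ i t, HasDerivAt (fun t => u (γ i t)) (v (γ i t) * deriv (γ i) t) t) {z : ℂ}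
    (hz : z ∉ frontier Ω) : HasDerivAt (cauchyIntegral γ u) (cauchyIntegral γ v z) z := by
  obtain ⟨ε, hε, hball⟩ := exists_ball_of_notMem_frontier hz
  obtain ⟨B, hB⟩ :=
    (isCompact_frontier hΩ).exists_bound_of_continuousOn (continuousOn_of_bdrySmooth hΩ hu)
  have hne : ∀ w ∈ Metric.ball z ε, ∀ i t, γ i t - w ≠ 0 := fun w hw i t =>
    norm_pos_iff.1 (hε.trans_le (hball _ (hΩ.mem_frontier i t) w hw))
  have hzb := Metric.mem_ball_self (x := z) hε
  unfold cauchyIntegral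
  refine HasDerivAt.const_mul _ (HasDerivAt.fun_sum fun i _ => ?_)
  have hcu : Continuous fun t => u (γ i t) := (hu i).continuous
  have hcv : Continuous fun t => v (γ i t) := (hv i).continuous
  have hc := hΩ.continuous i
  have hc' := hΩ.continuous_deriv i
  have hcF : ∀ w ∈ Metric.ball z ε,
      Continuous fun t => u (γ i t) / (γ i t - w) * deriv (γ i) t := fun w hw =>
    (hcu.div (hc.sub continuous_const) (hne w hw i)).mul hc'
  have hcF' : Continuous fun t => u (γ i t) / (γ i t - z) ^ 2 * deriv (γ i) t :=
    (hcu.div ((hc.sub continuous_const).pow 2) fun t => pow_ne_zero _ (hne z hzb i t)).mul hc'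
  have hmain := (intervalIntegral.hasDerivAt_integral_of_dominated_loc_of_deriv_le (μ := volume)
    (a := 0) (b := 1) (F := fun w t => u (γ i t) / (γ i t - w) * deriv (γ i) t)
    (F' := fun w t => u (γ i t) / (γ i t - w) ^ 2 * deriv (γ i) t)
    (bound := fun t => B / ε ^ 2 * ‖deriv (γ i) t‖) (Metric.ball_mem_nhds z hε)
    (by filter_upwards [Metric.ball_mem_nhds z hε] with w hw using
      (hcF w hw).aestronglyMeasurable)
    ((hcF z hzb).intervalIntegrable _ _) hcF'.aestronglyMeasurable
    (Eventually.of_forall fun t _ w hw => by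
      rw [norm_mul, norm_div, norm_pow]
      have := hball _ (hΩ.mem_frontier i t) w hw
      have := hB _ (hΩ.mem_frontier i t)
      have := (norm_nonneg _).trans this
      gcongr)
    ((continuous_const.mul hc'.norm).intervalIntegrable _ _)
    (Eventually.of_forall fun t _ w hw => by
      have h1 := ((hasDerivAt_const w (u (γ i t))).div ((hasDerivAt_const w (γ i t)).sub
        (hasDerivAt_id w)) (hne w hw i t)).mul_const (deriv (γ i) t)
      convert! h1 using 1
      simp)).2
  convert! hmain using 1
  -- the two integrands differ by the derivative of `u / (γ - z)`, a function of period one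
  have hd : ∀ t, HasDerivAt (fun t => u (γ i t) / (γ i t - z))
      (v (γ i t) / (γ i t - z) * deriv (γ i) t - u (γ i t) / (γ i t - z) ^ 2 * deriv (γ i) t) t :=
    fun t => by
      have h1 := (huv i t).div ((hΩ.hasDerivAt i t).sub_const z) (hne z hzb i t)
      convert! h1 using 1
      have := hne z hzb i t
      field_simp
  have hI1 : IntervalIntegrable (fun t => v (γ i t) / (γ i t - z) * deriv (γ i) t) volume 0 1 :=
    ((hcv.div (hc.sub continuous_const) (hne z hzb i)).mul hc').intervalIntegrable _ _
  have hI2 := hcF'.intervalIntegrable (μ := volume) 0 1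
  have h2 := intervalIntegral.integral_eq_sub_of_hasDerivAt (fun t _ => hd t) (hI1.sub hI2)
  have h3 : γ i 1 = γ i 0 := by simpa using hΩ.periodic i 0
  rw [intervalIntegral.integral_sub hI1 hI2, h3, sub_self] at h2
  exact sub_eq_zero.1 h2

theorem bdrySmooth_const (c : ℂ) : BdrySmooth γ fun _ => c := fun _ => contDiff_const

/-! ### Winding numbers -/

/-- The jump of the integral of the Cauchy kernel across a line, over a window of length one. As
`ε → 0` it tends to `2πi`. -/
theorem integral_tangent_sub (t₀ : ℝ) {ε : ℝ} (hε : 0 < ε) :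
    ∫ t in (t₀ - 1 / 2)..(t₀ - 1 / 2 + 1), ((((t - t₀ : ℝ) : ℂ) - ε * Complex.I)⁻¹ -
        (((t - t₀ : ℝ) : ℂ) - (-ε : ℝ) * Complex.I)⁻¹) =
      4 * Complex.I * (Real.arctan ((1 / 2) / ε) : ℝ) := by
  have hd : ∀ t : ℝ, HasDerivAt (fun t : ℝ => 2 * Complex.I * (Real.arctan ((t - t₀) / ε) : ℝ))
      ((((t - t₀ : ℝ) : ℂ) - ε * Complex.I)⁻¹ -
        (((t - t₀ : ℝ) : ℂ) - (-ε : ℝ) * Complex.I)⁻¹) t := by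
    intro t
    have h1 : HasDerivAt (fun t : ℝ => Real.arctan ((t - t₀) / ε))
        (1 / (1 + ((t - t₀) / ε) ^ 2) * (1 / ε)) t :=
      (((hasDerivAt_id t).sub_const t₀).div_const ε).arctan
    have h2 := h1.ofReal_comp.const_mul (2 * Complex.I)
    convert! h2 using 1
    set τ := t - t₀
    have h3 : ((τ : ℂ) - ε * Complex.I) ≠ 0 := fun h => hε.ne' (by
      simpa using congrArg Complex.im h)
    have h4 : ((τ : ℂ) + ε * Complex.I) ≠ 0 := fun h => hε.ne' (by
      simpa using congrArg Complex.im h)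
    have h5 : (τ : ℂ) ^ 2 + ε ^ 2 = ((τ : ℂ) - ε * Complex.I) * ((τ : ℂ) + ε * Complex.I) := by
      linear_combination (ε : ℂ) ^ 2 * Complex.I_sq
    have h6 : (ε : ℂ) ≠ 0 := by exact_mod_cast hε.ne'
    have h7 : (1 + ((τ : ℂ) / ε) ^ 2) = ((τ : ℂ) - ε * Complex.I) * ((τ : ℂ) + ε * Complex.I) /
        ε ^ 2 := by
      rw [← h5]; field_simp; ring
    push_cast
    rw [h7, neg_mul, sub_neg_eq_add]
    field_simp
    ring
  have hcont : Continuous fun t : ℝ => ((((t - t₀ : ℝ) : ℂ) - ε * Complex.I)⁻¹ -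
      (((t - t₀ : ℝ) : ℂ) - (-ε : ℝ) * Complex.I)⁻¹) := by
    refine (Continuous.inv₀ (by fun_prop) fun t h => ?_).sub
      (Continuous.inv₀ (by fun_prop) fun t h => ?_)
    · exact hε.ne' (by simpa using congrArg Complex.im h)
    · exact hε.ne' (by simpa using congrArg Complex.im h)
  rw [intervalIntegral.integral_eq_sub_of_hasDerivAt (fun t _ => hd t)
    (hcont.intervalIntegrable _ _)]
  rw [show t₀ - 1 / 2 + 1 - t₀ = 1 / 2 by ring, show t₀ - 1 / 2 - t₀ = -(1 / 2) by ring, neg_div,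
    Real.arctan_neg]
  push_cast
  ring

namespace IsSmoothDomain

variable (hΩ : IsSmoothDomain Ω γ)
include hΩ

/-- First order Taylor estimates, uniform over the boundary. -/
theorem exists_taylor : ∃ M > 0, (∀ i (s t : ℝ), ‖deriv (γ i) t - deriv (γ i) s‖ ≤ M * |t - s|) ∧
    ∀ i (s t : ℝ), ‖deriv (γ i) t * (t - s : ℝ) - (γ i t - γ i s)‖ ≤ M * |t - s| ^ 2 := by
  have hM : ∀ i, ∀ᶠ M in atTop, ∀ t, ‖deriv (deriv (γ i)) t‖ ≤ M := fun i => by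
    obtain ⟨M, -, hM⟩ := exists_bound_of_periodic (periodic_deriv (periodic_deriv (hΩ.periodic i)))
      ((hΩ.contDiff_deriv i).continuous_deriv (by simp))
    filter_upwards [eventually_ge_atTop M] with M' hM' t
    exact (hM t).trans hM'
  obtain ⟨M, hM, hM0⟩ := ((eventually_all.2 hM).and (eventually_gt_atTop (0 : ℝ))).exists
  have h1 : ∀ i (s t : ℝ), ‖deriv (γ i) t - deriv (γ i) s‖ ≤ M * |t - s| := fun i s t =>
    Convex.norm_image_sub_le_of_norm_deriv_le (s := univ)
      (fun x _ => (hΩ.contDiff_deriv i).differentiable (by simp) x) (fun x _ => hM i x) convex_univ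
      (mem_univ _) (mem_univ _)
  refine ⟨M, hM0, h1, fun i s t => ?_⟩
  have h2 : ∀ x, HasDerivAt (fun x : ℝ => deriv (γ i) t * (x : ℂ) - γ i x)
      (deriv (γ i) t - deriv (γ i) x) x := fun x => by
    simpa using ((Complex.ofRealCLM.hasDerivAt (x := x)).const_mul (deriv (γ i) t)).fun_sub
      (hΩ.hasDerivAt i x)
  have h3 := Convex.norm_image_sub_le_of_norm_hasDerivWithin_le (s := uIcc s t)
    (C := M * |t - s|) (fun x _ => (h2 x).hasDerivWithinAt) (fun x hx => ?_)
    (convex_uIcc s t) left_mem_uIcc right_mem_uIcc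
  · rw [Real.norm_eq_abs, mul_assoc, ← sq] at h3
    convert! h3 using 2
    push_cast
    ring
  · refine (h1 i x t).trans ?_
    gcongr M * ?_
    exact abs_sub_right_of_mem_uIcc hx

/-- Points on the normal line are at a distance from the curve comparable to the corresponding
distance for the tangent line. -/
theorem exists_normal_bound (i : Fin n) (t₀ : ℝ) : ∃ c > 0, ∀ᶠ ε : ℝ in 𝓝 0, ∀ t : ℝ,
    |t - t₀| ≤ 1 / 2 → c * ‖((t - t₀ : ℝ) : ℂ) - ε * Complex.I‖ ≤
      ‖γ i t - (γ i t₀ + ε * (Complex.I * deriv (γ i) t₀))‖ := by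
  obtain ⟨c, hc, hch, -⟩ := hΩ.exists_chord
  obtain ⟨M, hM, -, htay⟩ := hΩ.exists_taylor
  set a := deriv (γ i) t₀ with ha
  have ha0 : 0 < ‖a‖ := norm_pos_iff.2 (hΩ.deriv_ne_zero i t₀)
  -- up to `|t - t₀| = δ` the Taylor error is at most half of the linear term
  set δ := ‖a‖ / (2 * M) with hδ
  have hδ0 : 0 < δ := by positivity
  have hsmall : ∀ᶠ ε : ℝ in 𝓝 0, |ε| < 1 / 2 ∧ |ε| * ‖a‖ < c * δ / 2 := by
    have h1 : Tendsto (fun ε : ℝ => |ε|) (𝓝 0) (𝓝 0) := by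
      simpa using (continuous_abs (G := ℝ)).tendsto 0
    have h2 : Tendsto (fun ε : ℝ => |ε| * ‖a‖) (𝓝 0) (𝓝 0) := by simpa using h1.mul_const ‖a‖
    exact (h1.eventually_lt_const (by norm_num)).and (h2.eventually_lt_const (by positivity))
  refine ⟨min (‖a‖ / 2) (c * δ / 2), by positivity, ?_⟩
  filter_upwards [hsmall] with ε hε t ht
  set τ := t - t₀ with hτ
  have hre : |τ| ≤ ‖(τ : ℂ) - ε * Complex.I‖ := by
    simpa using Complex.abs_re_le_norm ((τ : ℂ) - ε * Complex.I)
  rcases le_total |τ| δ with h | h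
  · have h1 : ‖γ i t - γ i t₀ - a * τ‖ ≤ ‖a‖ / 2 * |τ| := by
      have h2 := htay i t t₀
      rw [show deriv (γ i) t₀ * ((t₀ - t : ℝ) : ℂ) - (γ i t₀ - γ i t) = γ i t - γ i t₀ - a * τ by
        rw [hτ, ← ha]; push_cast; ring, abs_sub_comm, ← hτ] at h2
      calc _ ≤ M * |τ| ^ 2 := h2
        _ = M * |τ| * |τ| := by ring
        _ ≤ M * δ * |τ| := by gcongr
        _ = _ := by rw [hδ]; field_simp
    have h2 : γ i t - (γ i t₀ + ε * (Complex.I * a)) =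
        a * ((τ : ℂ) - ε * Complex.I) + (γ i t - γ i t₀ - a * τ) := by ring
    have h3 := norm_sub_le_norm_add (a * ((τ : ℂ) - ε * Complex.I)) (γ i t - γ i t₀ - a * τ)
    rw [norm_mul] at h3
    rw [h2]
    calc _ ≤ ‖a‖ / 2 * ‖(τ : ℂ) - ε * Complex.I‖ := by gcongr; exact min_le_left _ _
      _ ≤ _ := by nlinarith
  · have h1 : ‖(τ : ℂ) - ε * Complex.I‖ ≤ 1 := by
      refine (norm_sub_le _ _).trans ?_
      rw [norm_mul, Complex.norm_real, Complex.norm_real, Complex.norm_I, Real.norm_eq_abs,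
        Real.norm_eq_abs, mul_one]
      linarith [hε.1]
    have h2 : c * δ ≤ ‖γ i t - γ i t₀‖ := le_trans (by gcongr) (hch i t₀ t ht)
    have h3 := norm_sub_norm_le (γ i t - γ i t₀) (ε * (Complex.I * a))
    rw [norm_mul (ε : ℂ), norm_mul, Complex.norm_I, one_mul, Complex.norm_real,
      Real.norm_eq_abs, sub_sub] at h3
    calc _ ≤ c * δ / 2 * 1 := by gcongr; exact min_le_right _ _
      _ ≤ _ := by linarith [hε.2]

/-- The Cauchy kernel of the curve differs from that of its tangent line by a bounded amount, so
the difference of their integrals is continuous across the curve. -/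
theorem tendsto_integral_sub_tangent (i : Fin n) (t₀ : ℝ) :
    Tendsto (fun ε : ℝ => ∫ t in (t₀ - 1 / 2)..(t₀ - 1 / 2 + 1),
      (deriv (γ i) t / (γ i t - (γ i t₀ + ε * (Complex.I * deriv (γ i) t₀))) -
        (((t - t₀ : ℝ) : ℂ) - ε * Complex.I)⁻¹)) (𝓝 0)
      (𝓝 (∫ t in (t₀ - 1 / 2)..(t₀ - 1 / 2 + 1),
        (deriv (γ i) t / (γ i t - γ i t₀) - ((t - t₀ : ℝ) : ℂ)⁻¹))) := by
  obtain ⟨c, hc, hnb⟩ := hΩ.exists_normal_bound i t₀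
  obtain ⟨M, hM, hlip, htay⟩ := hΩ.exists_taylor
  obtain ⟨c', hc', hch, -⟩ := hΩ.exists_chord
  have hm := (hΩ.continuous_deriv i).measurable
  have hm' := (hΩ.continuous i).measurable
  have hab : ∀ t ∈ uIoc (t₀ - 1 / 2) (t₀ - 1 / 2 + 1), |t - t₀| ≤ 1 / 2 := fun t ht => by
    rw [uIoc_of_le (by linarith)] at ht
    exact abs_le.2 ⟨by linarith [ht.1], by linarith [ht.2]⟩
  have hne : ∀ᵐ t : ℝ, t ≠ t₀ := by simp [ae_iff]
  refine intervalIntegral.tendsto_integral_filter_of_dominated_convergence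
    (fun _ => 2 * M / c) (Eventually.of_forall fun ε => ?_) ?_ (by simp) ?_
  · exact (by fun_prop : Measurable fun t =>
      (deriv (γ i) t / (γ i t - (γ i t₀ + ε * (Complex.I * deriv (γ i) t₀))) -
        (((t - t₀ : ℝ) : ℂ) - ε * Complex.I)⁻¹)).aestronglyMeasurable
  · filter_upwards [hnb] with ε hε
    filter_upwards [hne] with t hne ht
    have h1 := hε t (hab t ht)
    set a := deriv (γ i) t₀ with ha
    set τ := t - t₀ with hτ
    set w := (τ : ℂ) - ε * Complex.I with hw
    set d := γ i t - (γ i t₀ + ε * (Complex.I * a)) with hd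
    have hτw : |τ| ≤ ‖w‖ := by simpa [hw] using Complex.abs_re_le_norm w
    have hεw : |ε| ≤ ‖w‖ := by simpa [hw] using Complex.abs_im_le_norm w
    have hw0 : 0 < ‖w‖ := (abs_pos.2 (sub_ne_zero.2 hne)).trans_le hτw
    have hd0 : 0 < ‖d‖ := lt_of_lt_of_le (by positivity) h1
    have h2 : deriv (γ i) t / d - w⁻¹ = ((deriv (γ i) t * τ - (γ i t - γ i t₀)) -
        ε * Complex.I * (deriv (γ i) t - a)) / (d * w) := by
      have := norm_pos_iff.1 hw0
      have := norm_pos_iff.1 hd0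
      rw [← one_div, div_sub_div _ _ ‹d ≠ 0› ‹w ≠ 0›]
      congr 1
      rw [hd, hw]
      ring
    rw [h2, norm_div, norm_mul d, div_le_div_iff₀ (by positivity) hc]
    have h3 : ‖deriv (γ i) t * τ - (γ i t - γ i t₀) - ε * Complex.I * (deriv (γ i) t - a)‖
        ≤ 2 * M * ‖w‖ ^ 2 := by
      refine (norm_sub_le _ _).trans ?_
      rw [norm_mul, norm_mul, Complex.norm_I, mul_one, Complex.norm_real, Real.norm_eq_abs]
      have h4 := htay i t₀ t
      have h5 := hlip i t₀ t
      calc _ ≤ M * |τ| ^ 2 + |ε| * (M * |τ|) := by gcongr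
        _ ≤ M * ‖w‖ ^ 2 + ‖w‖ * (M * ‖w‖) := by gcongr
        _ = _ := by ring
    calc _ ≤ 2 * M * ‖w‖ ^ 2 * c := by gcongr
      _ = 2 * M * (c * ‖w‖ * ‖w‖) := by ring
      _ ≤ _ := by gcongr
  · filter_upwards [hne] with t hne ht
    have h1 : γ i t - γ i t₀ ≠ 0 := by
      rw [← norm_pos_iff]
      refine lt_of_lt_of_le ?_ (hch i t₀ t (hab t ht))
      have := abs_pos.2 (sub_ne_zero.2 hne)
      positivity
    have h2 : ((t - t₀ : ℝ) : ℂ) ≠ 0 := by exact_mod_cast sub_ne_zero.2 hne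
    have h3 : ContinuousAt (fun ε : ℝ =>
        deriv (γ i) t / (γ i t - (γ i t₀ + ε * (Complex.I * deriv (γ i) t₀))) -
        (((t - t₀ : ℝ) : ℂ) - ε * Complex.I)⁻¹) 0 := by
      refine (ContinuousAt.div (by fun_prop) (by fun_prop) (by simpa using h1)).sub
        (ContinuousAt.inv₀ (by fun_prop) (by simpa using h2))
    simpa using h3.tendsto

/-- The contribution of the other boundary curves is continuous across the `i`-th curve. -/
theorem tendsto_integral_ne {i j : Fin n} (hij : j ≠ i) (t₀ : ℝ) :
    Tendsto (fun ε : ℝ => ∫ t in (t₀ - 1 / 2)..(t₀ - 1 / 2 + 1),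
      deriv (γ j) t / (γ j t - (γ i t₀ + ε * (Complex.I * deriv (γ i) t₀)))) (𝓝 0)
      (𝓝 (∫ t in (t₀ - 1 / 2)..(t₀ - 1 / 2 + 1), deriv (γ j) t / (γ j t - γ i t₀))) := by
  obtain ⟨c, hc, -, hch⟩ := hΩ.exists_chord
  obtain ⟨M, hM, hMb⟩ := exists_bound_of_periodic (periodic_deriv (hΩ.periodic j))
    (hΩ.continuous_deriv j)
  have hm := (hΩ.continuous_deriv j).measurable
  have hm' := (hΩ.continuous j).measurable
  set a := deriv (γ i) t₀
  have hsmall : ∀ᶠ ε : ℝ in 𝓝 0, ‖(ε : ℂ) * (Complex.I * a)‖ < c / 2 := by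
    have : Continuous fun ε : ℝ => ‖(ε : ℂ) * (Complex.I * a)‖ := by fun_prop
    exact (this.tendsto 0).eventually_lt_const (by simpa using hc)
  refine intervalIntegral.tendsto_integral_filter_of_dominated_convergence
    (fun _ => M / (c / 2)) (Eventually.of_forall fun ε => ?_) ?_ (by simp) ?_
  · exact (by fun_prop : Measurable fun t =>
      deriv (γ j) t / (γ j t - (γ i t₀ + ε * (Complex.I * a)))).aestronglyMeasurable
  · filter_upwards [hsmall] with ε hε
    refine Eventually.of_forall fun t _ => ?_
    rw [norm_div]
    have h1 := hch j i t t₀ hij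
    have h2 := norm_sub_norm_le (γ j t - γ i t₀) (ε * (Complex.I * a))
    rw [sub_sub] at h2
    gcongr
    · exact hMb t
    · linarith
  · refine Eventually.of_forall fun t _ => ?_
    have h1 : γ j t - γ i t₀ ≠ 0 := norm_pos_iff.1 (hc.trans_le (hch j i t t₀ hij))
    have h3 : ContinuousAt (fun ε : ℝ =>
        deriv (γ j) t / (γ j t - (γ i t₀ + ε * (Complex.I * a)))) 0 :=
      ContinuousAt.div (by fun_prop) (by fun_prop) (by simpa using h1)
    simpa using h3.tendsto

end IsSmoothDomain

/-- The winding number of the boundary of `Ω`. -/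
def winding (γ : Fin n → ℝ → ℂ) : ℂ → ℂ := cauchyIntegral γ fun _ => 1

theorem hasDerivAt_winding (hΩ : IsSmoothDomain Ω γ) {z : ℂ} (hz : z ∉ frontier Ω) :
    HasDerivAt (winding γ) 0 z := by
  have h := hasDerivAt_cauchyIntegral hΩ (bdrySmooth_const 1) (bdrySmooth_const 0)
    (fun i t => by simpa using hasDerivAt_const t (1 : ℂ)) hz
  have h0 : cauchyIntegral γ (fun _ => (0 : ℂ)) z = 0 := by simp [cauchyIntegral]
  rw [h0] at h
  exact h

/-- The winding number as an integral over parameter windows centered at `t₀`. -/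
theorem winding_eq (hΩ : IsSmoothDomain Ω γ) (z : ℂ) (t₀ : ℝ) :
    2 * Real.pi * Complex.I * winding γ z =
      ∑ i, ∫ t in (t₀ - 1 / 2)..(t₀ - 1 / 2 + 1), deriv (γ i) t / (γ i t - z) := by
  rw [winding, cauchyIntegral, mul_inv_cancel_left₀ Complex.two_pi_I_ne_zero]
  refine Finset.sum_congr rfl fun i _ => ?_
  have hp : Function.Periodic (fun t => deriv (γ i) t / (γ i t - z)) 1 := fun t => by
    simp only [periodic_deriv (hΩ.periodic i) t, hΩ.periodic i t]
  have := hp.intervalIntegral_add_eq 0 (t₀ - 1 / 2)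
  rw [zero_add] at this
  rw [← this]
  refine intervalIntegral.integral_congr fun t _ => ?_
  simp only [one_div]
  ring

/-- The winding number jumps by one across the boundary. -/
theorem tendsto_winding_sub (hΩ : IsSmoothDomain Ω γ) (i : Fin n) (t₀ : ℝ) :
    Tendsto (fun ε : ℝ => winding γ (collar (γ i) (t₀ + ε * Complex.I)) -
      winding γ (collar (γ i) (t₀ + (-ε : ℝ) * Complex.I))) (𝓝[>] 0) (𝓝 1) := by
  classical
  set a := deriv (γ i) t₀ with ha
  have hcol : ∀ r : ℝ, collar (γ i) (t₀ + r * Complex.I) = γ i t₀ + r * (Complex.I * a) :=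
    fun r => by simp [collar, ha]
  simp only [hcol]
  -- `f j ε` is the contribution of the `j`-th curve, made continuous at `ε = 0`
  set f : Fin n → ℝ → ℂ := fun j ε => ∫ t in (t₀ - 1 / 2)..(t₀ - 1 / 2 + 1),
    (deriv (γ j) t / (γ j t - (γ i t₀ + ε * (Complex.I * a))) -
      if j = i then (((t - t₀ : ℝ) : ℂ) - ε * Complex.I)⁻¹ else 0) with hf
  have hlim : ∀ j, Tendsto (fun ε : ℝ => f j ε - f j (-ε)) (𝓝[>] 0) (𝓝 0) := by
    intro j
    have h1 : ∃ y, Tendsto (f j) (𝓝 0) (𝓝 y) := by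
      by_cases hj : j = i
      · subst hj
        simp only [hf, if_true]
        exact ⟨_, hΩ.tendsto_integral_sub_tangent j t₀⟩
      · simp only [hf, if_neg hj, sub_zero]
        exact ⟨_, hΩ.tendsto_integral_ne hj t₀⟩
    obtain ⟨y, hy⟩ := h1
    have h2 : Tendsto (fun ε : ℝ => -ε) (𝓝 0) (𝓝 0) := by
      simpa using continuous_neg.tendsto (0 : ℝ)
    have h3 := hy.sub (hy.comp h2)
    rw [sub_self] at h3
    exact h3.mono_left nhdsWithin_le_nhds
  have harc : Tendsto (fun ε : ℝ => 4 * Complex.I * (Real.arctan ((1 / 2) / ε) : ℝ)) (𝓝[>] 0)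
      (𝓝 (2 * Real.pi * Complex.I)) := by
    have h1 : Tendsto (fun ε : ℝ => (1 / 2) / ε) (𝓝[>] 0) atTop := by
      simp only [div_eq_mul_inv]
      exact tendsto_inv_nhdsGT_zero.const_mul_atTop (by norm_num)
    have h2 := (Real.tendsto_arctan_atTop.mono_right nhdsWithin_le_nhds).comp h1
    have h3 := ((Complex.continuous_ofReal.tendsto _).comp h2).const_mul (4 * Complex.I)
    convert! h3 using 2
    push_cast
    ring
  have hoff : ∀ᶠ ε : ℝ in 𝓝[>] 0, γ i t₀ + ε * (Complex.I * a) ∉ frontier Ω ∧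
      γ i t₀ + (-ε : ℝ) * (Complex.I * a) ∉ frontier Ω := by
    have hs := hΩ.collar_sides i t₀
    have hcv : ∀ κ : ℝ, Tendsto (fun r : ℝ => (t₀ : ℂ) + (κ * r : ℝ) * Complex.I) (𝓝[>] 0)
        (𝓝 (t₀ : ℂ)) := fun κ => by
      have : Continuous (fun r : ℝ => (t₀ : ℂ) + (κ * r : ℝ) * Complex.I) := by fun_prop
      simpa using (this.tendsto 0).mono_left nhdsWithin_le_nhds
    filter_upwards [(hcv 1).eventually hs, (hcv (-1)).eventually hs, self_mem_nhdsWithin]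
      with ε h1 h2 hε
    have hε : 0 < ε := hε
    rw [hcol] at h1 h2
    constructor
    · intro h
      have h3 := h1.1 (by simpa using hε)
      rw [one_mul] at h3
      exact h.2 (by rwa [hΩ.isOpen.interior_eq])
    · intro h
      have h3 := h2.2 (by simpa using hε)
      rw [neg_one_mul] at h3
      exact h3 h.1
  have hmain := (((tendsto_finsetSum Finset.univ fun j _ => hlim j).add harc).const_mul
    (2 * Real.pi * Complex.I)⁻¹)
  rw [Finset.sum_const_zero, zero_add, inv_mul_cancel₀ Complex.two_pi_I_ne_zero] at hmain
  refine hmain.congr' ?_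
  filter_upwards [hoff, self_mem_nhdsWithin] with ε hε hε0
  have hε0 : 0 < ε := hε0
  rw [inv_mul_eq_iff_eq_mul₀ Complex.two_pi_I_ne_zero, mul_sub, winding_eq hΩ _ t₀,
    winding_eq hΩ _ t₀, ← Finset.sum_sub_distrib]
  -- subtracting the tangent line kernel from the `i`-th term only
  have hint : ∀ z ∉ frontier Ω, ∀ j, IntervalIntegrable (fun t => deriv (γ j) t / (γ j t - z))
      volume (t₀ - 1 / 2) (t₀ - 1 / 2 + 1) := fun z hz j =>
    ((hΩ.continuous_deriv j).div ((hΩ.continuous j).sub (continuous_const : Continuous fun _ => z))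
      fun t h => hz ((sub_eq_zero.1 h : γ j t = z) ▸ hΩ.mem_frontier j t)).intervalIntegrable _ _
  have hint' : ∀ r : ℝ, r ≠ 0 → IntervalIntegrable (fun t : ℝ =>
      (((t - t₀ : ℝ) : ℂ) - r * Complex.I)⁻¹) volume (t₀ - 1 / 2) (t₀ - 1 / 2 + 1) := fun r hr =>
    (Continuous.inv₀ (by fun_prop) fun t h => hr (by
      simpa using congrArg Complex.im h)).intervalIntegrable _ _
  have hfeq : ∀ r : ℝ, r ≠ 0 → γ i t₀ + r * (Complex.I * a) ∉ frontier Ω → ∀ j, f j r =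
      (∫ t in (t₀ - 1 / 2)..(t₀ - 1 / 2 + 1),
        deriv (γ j) t / (γ j t - (γ i t₀ + r * (Complex.I * a)))) -
      if j = i then ∫ t in (t₀ - 1 / 2)..(t₀ - 1 / 2 + 1), (((t - t₀ : ℝ) : ℂ) - r * Complex.I)⁻¹
        else 0 := by
    intro r hr hrf j
    by_cases hj : j = i
    · simp only [hf, if_pos hj]
      rw [intervalIntegral.integral_sub (hint _ hrf j) (hint' r hr)]
    · simp only [hf, if_neg hj, sub_zero]
  have htan := integral_tangent_sub t₀ hε0
  rw [intervalIntegral.integral_sub (hint' ε hε0.ne') (hint' (-ε) (neg_ne_zero.2 hε0.ne'))] at htan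
  simp only [hfeq ε hε0.ne' hε.1, hfeq (-ε) (neg_ne_zero.2 hε0.ne') hε.2]
  simp only [Finset.sum_sub_distrib, Finset.sum_ite_eq', Finset.mem_univ, if_true]
  rw [← htan]
  ring

/-- Just outside of `Ω` the winding number is one less than inside. -/
theorem eventually_winding_eq (hΩ : IsSmoothDomain Ω γ) {z₀ : ℂ} (hz₀ : z₀ ∈ Ω) {p : ℂ}
    (hp : p ∈ frontier Ω) :
    ∀ᶠ z in 𝓝 p, z ∉ closure Ω → winding γ z = winding γ z₀ - 1 := by
  obtain ⟨i, t₀, rfl⟩ := hΩ.exists_param hp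
  have hin : ∀ z ∈ Ω, winding γ z = winding γ z₀ := fun z hz =>
    hΩ.isOpen.is_const_of_deriv_eq_zero hΩ.isConnected.isPreconnected
      (fun w hw => (hasDerivAt_winding hΩ fun h => h.2
        (by rwa [hΩ.isOpen.interior_eq])).differentiableAt.differentiableWithinAt)
      (fun w hw => (hasDerivAt_winding hΩ fun h => h.2
        (by rwa [hΩ.isOpen.interior_eq])).deriv) hz hz₀
  obtain ⟨r, hr, hs⟩ := Metric.eventually_nhds_iff_ball.1 (hΩ.collar_sides i t₀)
  set U := Metric.ball (t₀ : ℂ) r ∩ {w | w.im < 0} with hU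
  have hUo : IsOpen U := Metric.isOpen_ball.inter
    (isOpen_lt Complex.continuous_im continuous_const)
  have hUc : Convex ℝ U := (convex_ball _ _).inter
    ((convex_Iio (0 : ℝ)).linear_preimage Complex.imCLM.toLinearMap)
  have hUd : ∀ w ∈ U, HasFDerivAt (winding γ ∘ collar (γ i)) (0 : ℂ →L[ℝ] ℂ) w := fun w hw => by
    have h1 := (hasDerivAt_winding hΩ fun h => (hs w hw.1).2 hw.2 h.1).complexToReal_fderiv.comp w
      ((hΩ.contDiff_collar i).differentiable (by simp) w).hasFDerivAt
    simpa using h1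
  have hcv : ∀ κ : ℝ, Tendsto (fun r : ℝ => (t₀ : ℂ) + (κ * r : ℝ) * Complex.I) (𝓝[>] 0)
      (𝓝 (t₀ : ℂ)) := fun κ => by
    have : Continuous (fun r : ℝ => (t₀ : ℂ) + (κ * r : ℝ) * Complex.I) := by fun_prop
    simpa using (this.tendsto 0).mono_left nhdsWithin_le_nhds
  have hout : ∀ w ∈ U, winding γ (collar (γ i) w) = winding γ z₀ - 1 := by
    intro w hw
    have h1 : Tendsto (fun ε : ℝ => winding γ (collar (γ i) (t₀ + ε * Complex.I)) -
        winding γ (collar (γ i) (t₀ + (-ε : ℝ) * Complex.I))) (𝓝[>] 0)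
        (𝓝 (winding γ z₀ - winding γ (collar (γ i) w))) := by
      refine tendsto_const_nhds.congr' ?_
      filter_upwards [(hcv 1).eventually (Metric.ball_mem_nhds _ hr),
        (hcv (-1)).eventually (Metric.ball_mem_nhds _ hr), self_mem_nhdsWithin] with ε h1 h2 hε
      rw [one_mul] at h1
      rw [neg_one_mul] at h2
      have hε : 0 < ε := hε
      rw [hin _ ((hs _ h1).1 (by simpa using hε))]
      congr 1
      exact hUo.is_const_of_fderiv_eq_zero (𝕜 := ℝ) (f := winding γ ∘ collar (γ i))
        hUc.isPreconnected (fun w hw => (hUd w hw).differentiableAt.differentiableWithinAt)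
        (fun w hw => (hUd w hw).fderiv) hw ⟨h2, by simpa using hε⟩
    have h2 := tendsto_nhds_unique h1 (tendsto_winding_sub hΩ i t₀)
    linear_combination -h2
  have hmap := (hΩ.hasStrictFDerivAt_collar i t₀).map_nhds_eq_of_equiv
  rw [collar_ofReal] at hmap
  rw [← hmap, eventually_map]
  filter_upwards [Metric.ball_mem_nhds _ hr] with w hw hwc
  rcases lt_trichotomy w.im 0 with h | h | h
  · exact hout w ⟨hw, h⟩
  · have : w = (w.re : ℂ) := Complex.ext rfl (by simp [h])
    rw [this, collar_ofReal] at hwc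
    exact absurd (frontier_subset_closure (hΩ.mem_frontier i _)) hwc
  · exact absurd (subset_closure ((hs w hw).1 h)) hwc

theorem frontier_nonempty (hΩ : IsSmoothDomain Ω γ) : (frontier Ω).Nonempty := by
  refine nonempty_frontier_iff.2 ⟨hΩ.isConnected.nonempty, fun h => ?_⟩
  exact NormedSpace.unbounded_univ ℝ ℂ (h ▸ hΩ.isBounded)

/-- Outside of `Ω` the winding number is one less than inside: the disc around a point which
reaches up to the nearest boundary point does not meet the boundary. -/
theorem winding_eq_sub_one (hΩ : IsSmoothDomain Ω γ) {z₀ z : ℂ} (hz₀ : z₀ ∈ Ω)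
    (hz : z ∉ closure Ω) : winding γ z = winding γ z₀ - 1 := by
  obtain ⟨p, hp, hdist⟩ := (isCompact_frontier hΩ).exists_infDist_eq_dist (frontier_nonempty hΩ) z
  have hpz : 0 < dist z p := dist_pos.2 fun h => hz (h ▸ frontier_subset_closure hp)
  set D := Metric.ball z (dist z p) with hD
  have hDf : ∀ w ∈ D, w ∉ frontier Ω := fun w hw hwf => by
    have := Metric.infDist_le_dist_of_mem (x := z) hwf
    rw [hdist, dist_comm z w] at this
    exact absurd (Metric.mem_ball.1 hw) (not_lt.2 this)
  have hDc : D ⊆ (closure Ω)ᶜ := by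
    refine (convex_ball z _).isPreconnected.subset_right_of_subset_union hΩ.isOpen
      isClosed_closure.isOpen_compl (disjoint_compl_right_iff_subset.2 subset_closure)
      (fun w hw => ?_) ⟨z, Metric.mem_ball_self hpz, hz⟩
    by_contra hn
    rw [mem_union, not_or, notMem_compl_iff] at hn
    exact hDf w hw ⟨hn.2, by rw [hΩ.isOpen.interior_eq]; exact hn.1⟩
  have hcl : p ∈ closure D := by
    rw [hD, closure_ball z hpz.ne', Metric.mem_closedBall, dist_comm]
  obtain ⟨w, hw, hwD⟩ := ((mem_closure_iff_frequently.1 hcl).and_eventually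
    (eventually_winding_eq hΩ hz₀ hp)).exists
  rw [← hwD (hDc hw)]
  exact Metric.isOpen_ball.is_const_of_deriv_eq_zero (convex_ball z _).isPreconnected
    (fun w hw => (hasDerivAt_winding hΩ (hDf w hw)).differentiableAt.differentiableWithinAt)
    (fun w hw => (hasDerivAt_winding hΩ (hDf w hw)).deriv) (Metric.mem_ball_self hpz) hw

/-- The winding number of the exterior is constant and vanishes at infinity. -/
theorem winding_of_mem (hΩ : IsSmoothDomain Ω γ) {z : ℂ} (hz : z ∈ Ω) : winding γ z = 1 := by
  have h1 := tendsto_cauchyIntegral_cocompact hΩ (continuousOn_const (c := (1 : ℂ)))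
  have h2 : Tendsto (winding γ) (cocompact ℂ) (𝓝 (winding γ z - 1)) := by
    refine tendsto_const_nhds.congr' ?_
    have hc : IsCompact (closure Ω) := hΩ.isBounded.isCompact_closure
    filter_upwards [hc.compl_mem_cocompact] with w hw
    exact (winding_eq_sub_one hΩ hz hw).symm
  exact (sub_eq_zero.1 (tendsto_nhds_unique h2 h1))

theorem winding_of_notMem (hΩ : IsSmoothDomain Ω γ) {z : ℂ} (hz : z ∉ closure Ω) :
    winding γ z = 0 := by
  obtain ⟨z₀, hz₀⟩ := hΩ.isConnected.nonempty
  rw [winding_eq_sub_one hΩ hz₀ hz, winding_of_mem hΩ hz₀, sub_self]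

/-! ### Boundary values of Cauchy integrals -/

/-- The regularized Cauchy integral `(1 / 2πi) ∫ (u(ζ) - u(q)) / (ζ - q) dζ` at a boundary
point `q`. For smooth `u` the integrand is bounded; the value of the kernel at `ζ = q` is
irrelevant, as points have arc length zero. -/
def regularizedCauchy (γ : Fin n → ℝ → ℂ) (u : ℂ → ℂ) (q : ℂ) : ℂ :=
  (2 * Real.pi * Complex.I)⁻¹ *
    ∫ ζ, (u ζ - u q) / (ζ - q) * unitTangent γ ζ ∂(arcLength γ)

theorem notMem_frontier_of_mem (hΩ : IsOpen Ω) {z : ℂ} (hz : z ∈ Ω) : z ∉ frontier Ω :=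
  fun h => h.2 (by rwa [hΩ.interior_eq])

theorem aestronglyMeasurable_kernel (hΩ : IsSmoothDomain Ω γ) {u : ℂ → ℂ}
    (hu : ContinuousOn u (frontier Ω)) (c z : ℂ) :
    AEStronglyMeasurable (fun ζ => (u ζ - c) / (ζ - z) * unitTangent γ ζ) (arcLength γ) := by
  have h1 := (ContinuousOn.aestronglyMeasurable_arcLength hΩ hu).aemeasurable
  have h2 := (ContinuousOn.aestronglyMeasurable_arcLength hΩ
    (continuousOn_of_bdrySmooth hΩ (bdrySmooth_unitTangent hΩ))).aemeasurable
  exact (((h1.sub_const c).div (aemeasurable_id.sub_const z)).mul h2).aestronglyMeasurable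

/-- Nearest boundary points depend continuously on the point at boundary points, for any choice `P`
of them. -/
theorem tendsto_nearest {P : ℂ → ℂ}
    (hP : ∀ z, P z ∈ frontier Ω ∧ ∀ ζ ∈ frontier Ω, dist z (P z) ≤ dist z ζ) {q : ℂ}
    (hq : q ∈ frontier Ω) : Tendsto P (𝓝 q) (𝓝[frontier Ω] q) := by
  refine tendsto_nhdsWithin_iff.2 ⟨?_, Eventually.of_forall fun z => (hP z).1⟩
  rw [tendsto_iff_dist_tendsto_zero]
  have h1 : Tendsto (fun z => 2 * dist z q) (𝓝 q) (𝓝 0) := by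
    have : Continuous fun z : ℂ => 2 * dist z q := by fun_prop
    simpa using this.tendsto q
  refine squeeze_zero (fun _ => dist_nonneg) (fun z => ?_) h1
  have h2 := (hP z).2 q hq
  have h3 := dist_triangle_left (P z) q z
  linarith

/-- Subtracting the value of `u` at the nearest boundary point makes the Cauchy kernel bounded, even
for a tangential approach to the boundary. -/
theorem tendsto_integral_sub_nearest (hΩ : IsSmoothDomain Ω γ) {u : ℂ → ℂ} (hu : BdrySmooth γ u)
    {P : ℂ → ℂ} (hP : ∀ z, P z ∈ frontier Ω ∧ ∀ ζ ∈ frontier Ω, dist z (P z) ≤ dist z ζ)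
    {q : ℂ} (hq : q ∈ frontier Ω) :
    Tendsto (fun z => ∫ ζ, (u ζ - u (P z)) / (ζ - z) * unitTangent γ ζ ∂(arcLength γ)) (𝓝 q)
      (𝓝 (∫ ζ, (u ζ - u q) / (ζ - q) * unitTangent γ ζ ∂(arcLength γ))) := by
  have := isFiniteMeasure_arcLength hΩ
  obtain ⟨L, hL, hLip⟩ := hu.exists_lipschitz hΩ
  have hcu := continuousOn_of_bdrySmooth hΩ hu
  have hPq := tendsto_nearest hP hq
  refine tendsto_integral_filter_of_dominated_convergence (fun _ => 2 * L)
    (Eventually.of_forall fun z => aestronglyMeasurable_kernel hΩ hcu _ z)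
    (Eventually.of_forall fun z => ?_) (integrable_const _) ?_
  · filter_upwards [ae_mem_frontier hΩ] with ζ hζ
    rw [norm_mul, norm_unitTangent hΩ hζ, mul_one, norm_div]
    refine div_le_of_le_mul₀ (norm_nonneg _) (by positivity) ?_
    refine (hLip ζ hζ _ (hP z).1).trans ?_
    -- `|ζ - P z| ≤ 2 |ζ - z|`, as `P z` is nearest to `z`
    have h2 := (hP z).2 ζ hζ
    have h3 := dist_triangle_left ζ (P z) z
    rw [← dist_eq_norm, ← dist_eq_norm, dist_comm ζ z]
    nlinarith
  · filter_upwards [ae_ne_arcLength hΩ q] with ζ hζ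
    refine Tendsto.mul_const _ (Tendsto.div ?_ ?_ (sub_ne_zero.2 hζ))
    · exact tendsto_const_nhds.sub ((hcu q hq).tendsto.comp hPq)
    · exact tendsto_const_nhds.sub tendsto_id

theorem cauchyIntegral_eq_winding (hΩ : IsSmoothDomain Ω γ) {u : ℂ → ℂ}
    (hu : ContinuousOn u (frontier Ω)) (c : ℂ) {z : ℂ} (hz : z ∉ frontier Ω) :
    cauchyIntegral γ u z = c * winding γ z + (2 * Real.pi * Complex.I)⁻¹ *
      ∫ ζ, (u ζ - c) / (ζ - z) * unitTangent γ ζ ∂(arcLength γ) := by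
  have hT := continuousOn_of_bdrySmooth hΩ (bdrySmooth_unitTangent hΩ)
  rw [winding, cauchyIntegral_eq hΩ hu hz, cauchyIntegral_eq hΩ continuousOn_const hz,
    mul_left_comm, ← mul_add, ← integral_const_mul c, ← integral_add]
  · congr 2
    funext ζ
    ring
  · exact ContinuousOn.integrable_arcLength hΩ (continuousOn_const.fun_mul
      ((continuousOn_div_sub continuousOn_const hz).fun_mul hT))
  · exact ContinuousOn.integrable_arcLength hΩ
      ((continuousOn_div_sub (hu.sub continuousOn_const) hz).fun_mul hT)

/-- The boundary values of a Cauchy integral from a side of the boundary on which the winding number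
is `m`. -/
theorem tendsto_cauchyIntegral (hΩ : IsSmoothDomain Ω γ) {u : ℂ → ℂ} (hu : BdrySmooth γ u)
    {W : Set ℂ} {m : ℂ} (hW : ∀ z ∈ W, z ∉ frontier Ω ∧ winding γ z = m) {q : ℂ}
    (hq : q ∈ frontier Ω) :
    Tendsto (cauchyIntegral γ u) (𝓝[W] q) (𝓝 (u q * m + regularizedCauchy γ u q)) := by
  have hcu := continuousOn_of_bdrySmooth hΩ hu
  have hex : ∀ z, ∃ p, p ∈ frontier Ω ∧ ∀ ζ ∈ frontier Ω, dist z p ≤ dist z ζ := fun z => by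
    obtain ⟨p, hp, h⟩ := (isCompact_frontier hΩ).exists_infDist_eq_dist ⟨q, hq⟩ z
    exact ⟨p, hp, fun ζ hζ => h ▸ Metric.infDist_le_dist_of_mem hζ⟩
  choose P hP using hex
  have hPq := tendsto_nearest hP hq
  have h1 := (((hcu q hq).tendsto.comp hPq).mul_const m).add
    ((tendsto_integral_sub_nearest hΩ hu hP hq).const_mul (2 * Real.pi * Complex.I)⁻¹)
  refine (h1.mono_left nhdsWithin_le_nhds).congr' ?_
  filter_upwards [self_mem_nhdsWithin] with z hz
  rw [cauchyIntegral_eq_winding hΩ hcu (u (P z)) (hW z hz).1, (hW z hz).2]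
  rfl

theorem tendsto_cauchyIntegral_inside (hΩ : IsSmoothDomain Ω γ) {u : ℂ → ℂ} (hu : BdrySmooth γ u)
    {q : ℂ} (hq : q ∈ frontier Ω) :
    Tendsto (cauchyIntegral γ u) (𝓝[Ω] q) (𝓝 (u q + regularizedCauchy γ u q)) := by
  simpa using tendsto_cauchyIntegral hΩ hu (m := 1)
    (fun z hz => ⟨notMem_frontier_of_mem hΩ.isOpen hz, winding_of_mem hΩ hz⟩) hq

theorem tendsto_cauchyIntegral_outside (hΩ : IsSmoothDomain Ω γ) {u : ℂ → ℂ} (hu : BdrySmooth γ u)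
    {q : ℂ} (hq : q ∈ frontier Ω) :
    Tendsto (cauchyIntegral γ u) (𝓝[(closure Ω)ᶜ] q) (𝓝 (regularizedCauchy γ u q)) := by
  simpa using tendsto_cauchyIntegral hΩ hu (W := (closure Ω)ᶜ) (m := 0)
    (fun z hz => ⟨fun h => hz h.1, winding_of_notMem hΩ hz⟩) hq

theorem continuousAt_cauchyIntegral (hΩ : IsSmoothDomain Ω γ) {u : ℂ → ℂ} (hu : BdrySmooth γ u)
    {z : ℂ} (hz : z ∉ frontier Ω) : ContinuousAt (cauchyIntegral γ u) z := by
  obtain ⟨v, hv, huv⟩ := hu.exists_tangential hΩ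
  exact (hasDerivAt_cauchyIntegral hΩ hu hv huv hz).continuousAt

/-! ### The Cauchy transform -/

theorem cauchyTransform_of_mem (hΩ : IsSmoothDomain Ω γ) {u : ℂ → ℂ} (hu : BdrySmooth γ u)
    {z : ℂ} (hz : z ∈ Ω) : cauchyTransform Ω γ u z = cauchyIntegral γ u z :=
  extendFrom_eq (subset_closure hz) ((continuousAt_cauchyIntegral hΩ hu
    (notMem_frontier_of_mem hΩ.isOpen hz)).tendsto.mono_left nhdsWithin_le_nhds)

/-- The Plemelj formula. -/
theorem cauchyTransform_of_mem_frontier (hΩ : IsSmoothDomain Ω γ) {u : ℂ → ℂ}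
    (hu : BdrySmooth γ u) {z : ℂ} (hz : z ∈ frontier Ω) :
    cauchyTransform Ω γ u z = u z + regularizedCauchy γ u z :=
  extendFrom_eq (frontier_subset_closure hz) (tendsto_cauchyIntegral_inside hΩ hu hz)

theorem continuousOn_cauchyTransform (hΩ : IsSmoothDomain Ω γ) {u : ℂ → ℂ} (hu : BdrySmooth γ u) :
    ContinuousOn (cauchyTransform Ω γ u) (closure Ω) := by
  refine continuousOn_extendFrom subset_rfl fun z hz => ?_
  by_cases h : z ∈ Ω
  · exact ⟨_, (continuousAt_cauchyIntegral hΩ hu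
      (notMem_frontier_of_mem hΩ.isOpen h)).tendsto.mono_left nhdsWithin_le_nhds⟩
  · exact ⟨_, tendsto_cauchyIntegral_inside hΩ hu ⟨hz, by rwa [hΩ.isOpen.interior_eq]⟩⟩

theorem hasDerivAt_cauchyTransform (hΩ : IsSmoothDomain Ω γ) {u v : ℂ → ℂ} (hu : BdrySmooth γ u)
    (hv : BdrySmooth γ v)
    (huv : ∀ i t, HasDerivAt (fun t => u (γ i t)) (v (γ i t) * deriv (γ i) t) t) {z : ℂ}
    (hz : z ∈ Ω) : HasDerivAt (cauchyTransform Ω γ u) (cauchyTransform Ω γ v z) z := by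
  rw [cauchyTransform_of_mem hΩ hv hz]
  refine (hasDerivAt_cauchyIntegral hΩ hu hv huv
    (notMem_frontier_of_mem hΩ.isOpen hz)).congr_of_eventuallyEq ?_
  filter_upwards [hΩ.isOpen.mem_nhds hz] with w hw using cauchyTransform_of_mem hΩ hu hw

theorem memAInf_of_derivatives (hΩ : IsOpen Ω) (H : ℕ → ℂ → ℂ)
    (hc : ∀ k, ContinuousOn (H k) (closure Ω))
    (hd : ∀ k, ∀ z ∈ Ω, HasDerivAt (H k) (H (k + 1) z) z) : MemAInf Ω (H 0) := by
  refine ⟨fun z hz => (hd 0 z hz).differentiableAt.differentiableWithinAt, hc 0,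
    fun k => ⟨H k, hc k, ?_⟩⟩
  induction k with
  | zero => intro z _; rw [iteratedDeriv_zero]
  | succ k ih =>
    intro z hz
    rw [iteratedDeriv_succ, ← (hd k z hz).deriv]
    refine Filter.EventuallyEq.deriv_eq ?_
    filter_upwards [hΩ.mem_nhds hz] with w hw using ih hw

/-- The Cauchy transform maps `C^∞(∂Ω)` into `A^∞(Ω)`: its derivatives are the Cauchy transforms of
the successive tangential derivatives. -/
theorem memAInf_cauchyTransform (hΩ : IsSmoothDomain Ω γ) {u : ℂ → ℂ} (hu : BdrySmooth γ u) :
    MemAInf Ω (cauchyTransform Ω γ u) := by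
  have hex : ∀ f : {f : ℂ → ℂ // BdrySmooth γ f}, ∃ g : {g : ℂ → ℂ // BdrySmooth γ g},
      ∀ i t, HasDerivAt (fun t => f.1 (γ i t)) (g.1 (γ i t) * deriv (γ i) t) t := fun f => by
    obtain ⟨v, hv, h⟩ := f.2.exists_tangential hΩ
    exact ⟨⟨v, hv⟩, h⟩
  choose D hD using hex
  refine memAInf_of_derivatives hΩ.isOpen (fun k => cauchyTransform Ω γ (D^[k] ⟨u, hu⟩).1)
    (fun k => continuousOn_cauchyTransform hΩ (D^[k] ⟨u, hu⟩).2) fun k z hz => ?_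
  rw [Function.iterate_succ_apply']
  exact hasDerivAt_cauchyTransform hΩ (Subtype.prop _) (Subtype.prop _) (hD _) hz

theorem bdrySmooth_cauchyTransform (hΩ : IsSmoothDomain Ω γ) {u : ℂ → ℂ} (hu : BdrySmooth γ u) :
    BdrySmooth γ (cauchyTransform Ω γ u) :=
  (memAInf_cauchyTransform hΩ hu).bdrySmooth hΩ

/-! ### Cauchy's integral formula -/

/-- The function which is `𝒞 h - h` on the closure of `Ω` and the Cauchy integral of `h` outside.
Cauchy's integral formula says that it vanishes. -/
def cauchyDefect (Ω : Set ℂ) (γ : Fin n → ℝ → ℂ) (h : ℂ → ℂ) (z : ℂ) : ℂ :=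
  open Classical in
  if z ∈ closure Ω then cauchyTransform Ω γ h z - h z else cauchyIntegral γ h z

theorem continuous_cauchyDefect (hΩ : IsSmoothDomain Ω γ) {h : ℂ → ℂ} (hh : BdrySmooth γ h)
    (hc : ContinuousOn h (closure Ω)) : Continuous (cauchyDefect Ω γ h) := by
  have h1 : ContinuousOn (cauchyDefect Ω γ h) (closure Ω) :=
    ((continuousOn_cauchyTransform hΩ hh).sub hc).congr fun z hz => if_pos hz
  have h2 : ContinuousOn (cauchyDefect Ω γ h) (closure (closure Ω)ᶜ) := by
    have h3 : ∀ z ∈ closure (closure Ω)ᶜ, Tendsto (cauchyIntegral γ h) (𝓝[(closure Ω)ᶜ] z)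
        (𝓝 (cauchyDefect Ω γ h z)) := by
      intro z hz
      by_cases hzc : z ∈ closure Ω
      · have hzf : z ∈ frontier Ω := ⟨hzc, fun h => by
          rw [closure_compl] at hz
          exact hz (interior_mono subset_closure h)⟩
        rw [cauchyDefect, if_pos hzc, cauchyTransform_of_mem_frontier hΩ hh hzf,
          add_sub_cancel_left]
        exact tendsto_cauchyIntegral_outside hΩ hh hzf
      · rw [cauchyDefect, if_neg hzc]
        exact (continuousAt_cauchyIntegral hΩ hh fun h => hzc h.1).tendsto.mono_left
          nhdsWithin_le_nhds
    exact (continuousOn_extendFrom subset_rfl fun z hz => ⟨_, h3 z hz⟩).congr fun z hz =>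
      (extendFrom_eq hz (h3 z hz)).symm
  rw [← continuousOn_univ]
  refine (h1.union_of_isClosed h2 isClosed_closure isClosed_closure).mono fun z _ => ?_
  exact (em (z ∈ closure Ω)).imp id fun h => subset_closure h

/-- Cauchy's integral formula, in the form that the defect vanishes. The defect is continuous on the
plane and holomorphic off the boundary, and its derivative is the defect of the derivative, so it is
an entire function. It tends to zero at infinity. -/
theorem cauchyDefect_eq_zero (hΩ : IsSmoothDomain Ω γ) {h g : ℂ → ℂ} (hh : BdrySmooth γ h)
    (hg : BdrySmooth γ g) (hc : ContinuousOn h (closure Ω)) (hgc : ContinuousOn g (closure Ω))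
    (hd : ∀ z ∈ Ω, HasDerivAt h (g z) z) (z : ℂ) : cauchyDefect Ω γ h z = 0 := by
  have htan := hΩ.hasDerivAt_comp hc hgc hd
  have hoff : ∀ z ∉ frontier Ω, HasDerivAt (cauchyDefect Ω γ h) (cauchyDefect Ω γ g z) z := by
    intro z hz
    by_cases hzc : z ∈ closure Ω
    · have hzΩ : z ∈ Ω := by
        by_contra hn
        exact hz ⟨hzc, by rwa [hΩ.isOpen.interior_eq]⟩
      rw [cauchyDefect, if_pos hzc]
      refine ((hasDerivAt_cauchyTransform hΩ hh hg htan hzΩ).sub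
        (hd z hzΩ)).congr_of_eventuallyEq ?_
      filter_upwards [hΩ.isOpen.mem_nhds hzΩ] with w hw
      exact if_pos (subset_closure hw)
    · rw [cauchyDefect, if_neg hzc]
      refine (hasDerivAt_cauchyIntegral hΩ hh hg htan hz).congr_of_eventuallyEq ?_
      filter_upwards [isClosed_closure.isOpen_compl.mem_nhds hzc] with w hw
      exact if_neg hw
  have hent : Differentiable ℂ (cauchyDefect Ω γ h) := fun z =>
    (hΩ.hasDerivAt_of_off_frontier (continuous_cauchyDefect hΩ hh hc)
      (continuous_cauchyDefect hΩ hg hgc) hoff z).differentiableAt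
  refine hent.apply_eq_of_tendsto_cocompact z ?_
  refine (tendsto_cauchyIntegral_cocompact hΩ (continuousOn_of_bdrySmooth hΩ hh)).congr' ?_
  filter_upwards [hΩ.isBounded.isCompact_closure.compl_mem_cocompact] with w hw
  exact (if_neg hw).symm

/-- `𝒞` is the identity on `A^∞(Ω)`. -/
theorem cauchyTransform_eq_self (hΩ : IsSmoothDomain Ω γ) {h : ℂ → ℂ} (hh : MemAInf Ω h) {z : ℂ}
    (hz : z ∈ closure Ω) : cauchyTransform Ω γ h z = h z := by
  obtain ⟨H, rfl, hc, hd⟩ := hh.exists_derivatives hΩ.isOpen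
  have h1 := cauchyDefect_eq_zero hΩ (hΩ.bdrySmooth_of_derivatives H hc hd 0)
    (hΩ.bdrySmooth_of_derivatives H hc hd 1) (hc 0) (hc 1) (hd 0) z
  rw [cauchyDefect, if_pos hz] at h1
  exact sub_eq_zero.1 h1

/-- Cauchy's theorem, obtained from the integral formula at `z₀ ∈ Ω` for `(z - z₀) h(z)`. -/
theorem integral_eq_zero_of_memAInf (hΩ : IsSmoothDomain Ω γ) {h : ℂ → ℂ} (hh : MemAInf Ω h) :
    ∫ ζ, h ζ * unitTangent γ ζ ∂(arcLength γ) = 0 := by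
  obtain ⟨H, rfl, hc, hd⟩ := hh.exists_derivatives hΩ.isOpen
  have hs := hΩ.bdrySmooth_of_derivatives H hc hd
  obtain ⟨z₀, hz₀⟩ := hΩ.isConnected.nonempty
  have hlin : BdrySmooth γ fun z => z - z₀ := fun i => (hΩ.contDiff i).sub contDiff_const
  have hk : BdrySmooth γ fun z => (z - z₀) * H 0 z := fun i => (hlin i).mul (hs 0 i)
  have h1 := cauchyDefect_eq_zero hΩ (h := fun z => (z - z₀) * H 0 z)
    (g := fun z => H 0 z + (z - z₀) * H 1 z) hk
    (fun i => (hs 0 i).add ((hlin i).mul (hs 1 i)))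
    (ContinuousOn.mul (by fun_prop) (hc 0))
    ((hc 0).add (ContinuousOn.mul (by fun_prop) (hc 1)))
    (fun z hz => by
      simpa using ((hasDerivAt_id z).sub_const z₀).fun_mul (hd 0 z hz)) z₀
  rw [cauchyDefect, if_pos (subset_closure hz₀), cauchyTransform_of_mem hΩ hk hz₀,
    cauchyIntegral_eq hΩ (continuousOn_of_bdrySmooth hΩ hk)
      (notMem_frontier_of_mem hΩ.isOpen hz₀), sub_self, zero_mul, sub_zero, mul_eq_zero] at h1
  rw [← h1.resolve_left (inv_ne_zero Complex.two_pi_I_ne_zero)]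
  refine integral_congr_ae ?_
  filter_upwards [ae_ne_arcLength hΩ z₀] with ζ hζ
  rw [mul_div_cancel_left₀ _ (sub_ne_zero.2 hζ)]

/-! ### The adjoint of the Cauchy transform -/

theorem integrable_kernel (hΩ : IsSmoothDomain Ω γ) {u : ℂ → ℂ} (hu : BdrySmooth γ u) {z : ℂ}
    (hz : z ∈ frontier Ω) :
    Integrable (fun ζ => (u ζ - u z) / (ζ - z) * unitTangent γ ζ) (arcLength γ) := by
  have := isFiniteMeasure_arcLength hΩ
  obtain ⟨L, hL, hLip⟩ := hu.exists_lipschitz hΩ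
  refine .of_bound (aestronglyMeasurable_kernel hΩ (continuousOn_of_bdrySmooth hΩ hu) _ z) L ?_
  filter_upwards [ae_mem_frontier hΩ] with ζ hζ
  rw [norm_mul, norm_unitTangent hΩ hζ, mul_one, norm_div]
  exact div_le_of_le_mul₀ (norm_nonneg _) hL (hLip ζ hζ z hz)

theorem BdrySmooth.mul {u v : ℂ → ℂ} (hu : BdrySmooth γ u) (hv : BdrySmooth γ v) :
    BdrySmooth γ fun z => u z * v z := fun i => (hu i).mul (hv i)

theorem BdrySmooth.conj {u : ℂ → ℂ} (hu : BdrySmooth γ u) : BdrySmooth γ fun z => conj (u z) :=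
  fun i => Complex.conjCLE.contDiff.comp (hu i)

theorem BdrySmooth.ofReal (hφ : BdrySmooth γ φ) : BdrySmooth γ fun z => (φ z : ℂ) :=
  fun i => Complex.ofRealCLM.contDiff.comp (hφ i)

/-- The double integral of an antisymmetric kernel vanishes. Fubini's theorem applies as the kernel
is bounded. -/
theorem integral_antisymm_kernel (hΩ : IsSmoothDomain Ω γ) {u w : ℂ → ℂ} (hu : BdrySmooth γ u)
    (hw : BdrySmooth γ w) :
    ∫ z, ∫ ζ, (u ζ - u z) * (w ζ - w z) / (ζ - z) * (unitTangent γ ζ * unitTangent γ z)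
      ∂(arcLength γ) ∂(arcLength γ) = 0 := by
  have := isFiniteMeasure_arcLength hΩ
  obtain ⟨L, hL, hLip⟩ := hu.exists_lipschitz hΩ
  obtain ⟨B, hB⟩ :=
    (isCompact_frontier hΩ).exists_bound_of_continuousOn (continuousOn_of_bdrySmooth hΩ hw)
  set σ := arcLength γ
  set k : ℂ → ℂ → ℂ := fun z ζ =>
    (u ζ - u z) * (w ζ - w z) / (ζ - z) * (unitTangent γ ζ * unitTangent γ z) with hk
  have hm : ∀ {f : ℂ → ℂ}, BdrySmooth γ f → AEMeasurable (fun p : ℂ × ℂ => f p.1) (σ.prod σ) ∧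
      AEMeasurable (fun p : ℂ × ℂ => f p.2) (σ.prod σ) := fun hf => by
    have h := ContinuousOn.aestronglyMeasurable_arcLength hΩ (continuousOn_of_bdrySmooth hΩ hf)
    exact ⟨h.comp_fst.aemeasurable, h.comp_snd.aemeasurable⟩
  have hT := bdrySmooth_unitTangent hΩ
  have hkm : AEStronglyMeasurable (Function.uncurry k) (σ.prod σ) :=
    (((((hm hu).2.sub (hm hu).1).mul ((hm hw).2.sub (hm hw).1)).div
      (measurable_snd.aemeasurable.sub measurable_fst.aemeasurable)).mul
      ((hm hT).2.mul (hm hT).1)).aestronglyMeasurable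
  have hki : Integrable (Function.uncurry k) (σ.prod σ) := by
    refine .of_bound hkm (L * (B + B)) ?_
    filter_upwards [Measure.quasiMeasurePreserving_fst.ae (ae_mem_frontier hΩ),
      Measure.quasiMeasurePreserving_snd.ae (ae_mem_frontier hΩ)] with p h1 h2
    simp only [Function.uncurry, hk]
    rw [norm_mul, norm_mul, norm_unitTangent hΩ h1, norm_unitTangent hΩ h2, mul_one, mul_one,
      norm_div, norm_mul]
    have hB0 : 0 ≤ B := (norm_nonneg _).trans (hB _ h1)
    refine div_le_of_le_mul₀ (norm_nonneg _) (by positivity) ?_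
    have h3 := hLip _ h2 _ h1
    have h4 : ‖w p.2 - w p.1‖ ≤ B + B := (norm_sub_le _ _).trans (add_le_add (hB _ h2) (hB _ h1))
    calc _ ≤ L * ‖p.2 - p.1‖ * (B + B) := by gcongr
      _ = _ := by ring
  have hanti : ∀ z ζ, k ζ z = - k z ζ := fun z ζ => by
    simp only [hk]
    rw [← neg_sub ζ z, div_neg]
    ring
  have hswap := integral_integral_swap hki
  have h1 : ∫ ζ, ∫ z, k z ζ ∂σ ∂σ = - ∫ z, ∫ ζ, k z ζ ∂σ ∂σ := by
    rw [← integral_neg]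
    refine integral_congr_ae (Eventually.of_forall fun z => ?_)
    dsimp only
    rw [← integral_neg]
    exact integral_congr_ae (Eventually.of_forall fun ζ => hanti z ζ)
  rw [h1] at hswap
  exact self_eq_neg.1 hswap

/-- The bilinear identity behind the formula for the adjoint. By the Plemelj formula the difference
of the two integrands is `𝒞(uw) T`, whose integral vanishes by Cauchy's theorem, up to the integral
of an antisymmetric kernel. -/
theorem integral_cauchyTransform_mul (hΩ : IsSmoothDomain Ω γ) {u w : ℂ → ℂ} (hu : BdrySmooth γ u)
    (hw : BdrySmooth γ w) :
    ∫ z, cauchyTransform Ω γ u z * w z * unitTangent γ z ∂(arcLength γ) =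
      ∫ z, u z * (w z - cauchyTransform Ω γ w z) * unitTangent γ z ∂(arcLength γ) := by
  have huw := hu.mul hw
  have hCu := bdrySmooth_cauchyTransform hΩ hu
  have hCw := bdrySmooth_cauchyTransform hΩ hw
  have hCuw := bdrySmooth_cauchyTransform hΩ huw
  have hT := bdrySmooth_unitTangent hΩ
  have hint : ∀ {f : ℂ → ℂ}, BdrySmooth γ f → Integrable f (arcLength γ) := fun hf =>
    ContinuousOn.integrable_arcLength hΩ (continuousOn_of_bdrySmooth hΩ hf)
  have hwC : BdrySmooth γ fun z => w z - cauchyTransform Ω γ w z := fun i => (hw i).sub (hCw i)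
  have h0 := integral_eq_zero_of_memAInf hΩ (memAInf_cauchyTransform hΩ huw)
  have hkey : ∫ z, (cauchyTransform Ω γ u z * w z * unitTangent γ z -
      u z * (w z - cauchyTransform Ω γ w z) * unitTangent γ z -
      cauchyTransform Ω γ (fun z => u z * w z) z * unitTangent γ z) ∂(arcLength γ) = 0 := by
    calc _ = ∫ z, -(2 * Real.pi * Complex.I)⁻¹ * ∫ ζ, (u ζ - u z) * (w ζ - w z) / (ζ - z) *
          (unitTangent γ ζ * unitTangent γ z) ∂(arcLength γ) ∂(arcLength γ) := by
          refine integral_congr_ae ?_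
          filter_upwards [ae_mem_frontier hΩ] with z hz
          have hk : ∫ ζ, (u ζ - u z) * (w ζ - w z) / (ζ - z) *
              (unitTangent γ ζ * unitTangent γ z) ∂(arcLength γ) = unitTangent γ z *
              ((∫ ζ, (u ζ * w ζ - u z * w z) / (ζ - z) * unitTangent γ ζ ∂(arcLength γ)) -
              w z * (∫ ζ, (u ζ - u z) / (ζ - z) * unitTangent γ ζ ∂(arcLength γ)) -
              u z * ∫ ζ, (w ζ - w z) / (ζ - z) * unitTangent γ ζ ∂(arcLength γ)) := by
            have i1 := integrable_kernel hΩ huw hz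
            have i2 := (integrable_kernel hΩ hu hz).const_mul (w z)
            have i3 := (integrable_kernel hΩ hw hz).const_mul (u z)
            rw [← integral_const_mul, ← integral_const_mul, ← integral_sub i1 i2,
              ← integral_sub ?_ i3, ← integral_const_mul]
            swap
            · exact i1.sub i2
            refine integral_congr_ae (Eventually.of_forall fun ζ => ?_)
            simp only [div_eq_mul_inv]
            ring
          rw [hk, cauchyTransform_of_mem_frontier hΩ hu hz,
            cauchyTransform_of_mem_frontier hΩ hw hz, cauchyTransform_of_mem_frontier hΩ huw hz]
          simp only [regularizedCauchy]
          ring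
      _ = 0 := by rw [integral_const_mul, integral_antisymm_kernel hΩ hu hw, mul_zero]
  have i1 := hint ((hCu.mul hw).mul hT)
  have i2 := hint ((hu.mul hwC).mul hT)
  have i3 : Integrable (fun z => cauchyTransform Ω γ u z * w z * unitTangent γ z -
      u z * (w z - cauchyTransform Ω γ w z) * unitTangent γ z) (arcLength γ) := i1.sub i2
  rw [integral_sub i3 (hint (hCuw.mul hT)), integral_sub i1 i2, h0, sub_zero] at hkey
  exact sub_eq_zero.1 hkey

theorem weightedArc_ae_mem (hΩ : IsSmoothDomain Ω γ) :
    ∀ᵐ z ∂(weightedArc γ φ), z ∈ frontier Ω :=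
  (withDensity_absolutelyContinuous _ _).ae_le (ae_mem_frontier hΩ)

theorem integral_weightedArc (hΩ : IsSmoothDomain Ω γ) (hφ : BdrySmooth γ φ)
    (hpos : ∀ z ∈ frontier Ω, 0 < φ z) {E : Type*} [NormedAddCommGroup E] [NormedSpace ℝ E]
    (f : ℂ → E) :
    ∫ z, f z ∂(weightedArc γ φ) = ∫ z, φ z • f z ∂(arcLength γ) := by
  have hm := (ContinuousOn.aestronglyMeasurable_arcLength hΩ
    (continuousOn_of_bdrySmooth hΩ hφ)).aemeasurable
  rw [weightedArc, integral_withDensity_eq_integral_toReal_smul₀ hm.ennreal_ofReal (by simp)]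
  refine integral_congr_ae ?_
  filter_upwards [ae_mem_frontier hΩ] with z hz
  rw [ENNReal.toReal_ofReal (hpos z hz).le]

theorem unitTangent_mul_conj (hΩ : IsSmoothDomain Ω γ) {z : ℂ} (hz : z ∈ frontier Ω) :
    unitTangent γ z * conj (unitTangent γ z) = 1 := by
  rw [Complex.mul_conj, Complex.normSq_eq_norm_sq, norm_unitTangent hΩ hz]
  simp

/-- The function to which `𝒞` is applied in the definition of `𝒞* v` is smooth. -/
theorem bdrySmooth_dual (hΩ : IsSmoothDomain Ω γ) (hφ : BdrySmooth γ φ) {v : ℂ → ℂ}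
    (hv : BdrySmooth γ v) :
    BdrySmooth γ fun ζ => conj (v ζ * (φ ζ : ℂ)) * conj (unitTangent γ ζ) :=
  (hv.mul hφ.ofReal).conj.mul (bdrySmooth_unitTangent hΩ).conj

theorem bdrySmooth_cauchyAdjoint (hΩ : IsSmoothDomain Ω γ) (hφ : BdrySmooth γ φ)
    (hpos : ∀ z ∈ frontier Ω, 0 < φ z) {v : ℂ → ℂ} (hv : BdrySmooth γ v) :
    BdrySmooth γ (cauchyAdjoint Ω γ φ v) := by
  have h1 : BdrySmooth γ fun z => (φ z : ℂ)⁻¹ := fun i => (hφ.ofReal i).inv fun t =>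
    Complex.ofReal_ne_zero.2 (hpos _ (hΩ.mem_frontier i t)).ne'
  have h2 := ((bdrySmooth_unitTangent hΩ).conj.mul h1).mul
    (bdrySmooth_cauchyTransform hΩ (bdrySmooth_dual hΩ hφ hv)).conj
  exact fun i => (hv i).sub (h2 i)

/-- The bilinear identity for `w = conj (v φ T)`, where `ds = conj T dz` on the boundary. -/
theorem wInner_cauchyTransform (hΩ : IsSmoothDomain Ω γ) (hφ : BdrySmooth γ φ)
    (hpos : ∀ z ∈ frontier Ω, 0 < φ z) {u v : ℂ → ℂ} (hu : BdrySmooth γ u) (hv : BdrySmooth γ v) :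
    wInner γ φ (cauchyTransform Ω γ u) v = wInner γ φ u (cauchyAdjoint Ω γ φ v) := by
  have h := integral_cauchyTransform_mul hΩ hu (bdrySmooth_dual hΩ hφ hv)
  rw [wInner, wInner, integral_weightedArc hΩ hφ hpos, integral_weightedArc hΩ hφ hpos]
  convert! h using 1
  · refine integral_congr_ae ?_
    filter_upwards [ae_mem_frontier hΩ] with z hz
    simp only [map_mul, Complex.conj_ofReal, Complex.real_smul]
    linear_combination -(cauchyTransform Ω γ u z * conj (v z) * φ z) * unitTangent_mul_conj hΩ hz
  · refine integral_congr_ae ?_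
    filter_upwards [ae_mem_frontier hΩ] with z hz
    have h0 : (φ z : ℂ) ≠ 0 := by exact_mod_cast (hpos z hz).ne'
    rw [cauchyAdjoint]
    generalize cauchyTransform Ω γ
      (fun ζ => conj (v ζ * (φ ζ : ℂ)) * conj (unitTangent γ ζ)) z = D
    simp only [map_sub, map_mul, map_inv₀, Complex.conj_ofReal, Complex.conj_conj,
      Complex.real_smul]
    have h1 : (φ z : ℂ) * (φ z : ℂ)⁻¹ = 1 := mul_inv_cancel₀ h0
    linear_combination -(u z * conj (v z) * φ z) * unitTangent_mul_conj hΩ hz -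
      u z * unitTangent γ z * D * h1

/-! ### The Kerzman–Stein kernel -/

/-- The double layer kernel is bounded. Indeed `T(ζ) / (ζ - z)` is a positive multiple of
`1 / (t - s)`, a real number, up to a bounded error. -/
theorem exists_double_layer_bound (hΩ : IsSmoothDomain Ω γ) : ∃ M, 0 ≤ M ∧ ∀ z ∈ frontier Ω,
    ∀ ζ ∈ frontier Ω,
      ‖unitTangent γ ζ / (ζ - z) - conj (unitTangent γ ζ) / conj (ζ - z)‖ ≤ M := by
  obtain ⟨c, hc, hch, hch'⟩ := hΩ.exists_chord
  obtain ⟨M, hM, -, htay⟩ := hΩ.exists_taylor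
  have hR : ∀ i, ∀ᶠ R in atTop, ∀ t, ‖(deriv (γ i) t)⁻¹‖ ≤ R := fun i => by
    obtain ⟨R, -, hR⟩ := exists_bound_of_periodic (f := fun t => (deriv (γ i) t)⁻¹)
      (fun t => congrArg (·⁻¹) (periodic_deriv (hΩ.periodic i) t))
      ((hΩ.continuous_deriv i).inv₀ (hΩ.deriv_ne_zero i))
    filter_upwards [eventually_ge_atTop R] with R' hR' t
    exact (hR t).trans hR'
  obtain ⟨R, hR, hR0⟩ := ((eventually_all.2 hR).and (eventually_ge_atTop (0 : ℝ))).exists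
  have hconj : ∀ a : ℂ, ‖a - conj a‖ ≤ 2 * ‖a‖ := fun a => by
    refine (norm_sub_le _ _).trans ?_
    rw [RCLike.norm_conj]; linarith
  refine ⟨max (2 * (1 / c)) (2 * (R * (M / c))), by positivity, fun z hz ζ hζ => ?_⟩
  obtain ⟨j, s, rfl⟩ := hΩ.exists_param hz
  obtain ⟨i, t, hts, rfl⟩ := hΩ.exists_param_near hζ s
  rw [← map_div₀]
  by_cases hij : i = j
  · subst hij
    by_cases hst : t = s
    · subst hst
      simp only [sub_self, div_zero, map_zero, norm_zero]
      positivity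
    refine le_trans ?_ (le_max_right _ _)
    have hst0 : (t - s : ℝ) ≠ 0 := sub_ne_zero.2 hst
    have hτ : 0 < |t - s| := abs_pos.2 hst0
    have hchord := hch i s t hts
    have hd : γ i t - γ i s ≠ 0 := norm_pos_iff.1 (lt_of_lt_of_le (by positivity) hchord)
    have hn : (‖deriv (γ i) t‖ : ℂ) ≠ 0 := by simpa using hΩ.deriv_ne_zero i t
    have hτ' : ((t - s : ℝ) : ℂ) ≠ 0 := by exact_mod_cast hst0
    -- the difference to the real number `1 / (|γ'(t)| (t - s))`
    set b : ℂ := unitTangent γ (γ i t) / (γ i t - γ i s) -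
      (((‖deriv (γ i) t‖ * (t - s))⁻¹ : ℝ) : ℂ) with hb
    have hbeq : b = (‖deriv (γ i) t‖ : ℂ)⁻¹ *
        ((deriv (γ i) t * (t - s : ℝ) - (γ i t - γ i s)) / ((γ i t - γ i s) * (t - s : ℝ))) := by
      rw [hb, unitTangent_apply hΩ]
      push_cast at hτ' ⊢
      field_simp
    have hbn : ‖b‖ ≤ R * (M / c) := by
      rw [hbeq, norm_mul, norm_div, norm_mul (γ i t - γ i s), norm_inv, Complex.norm_real,
        Complex.norm_real, norm_norm, ← norm_inv, Real.norm_eq_abs]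
      refine mul_le_mul (hR i t) ?_ (by positivity) hR0
      · rw [div_le_div_iff₀ (by positivity) hc]
        calc _ ≤ M * |t - s| ^ 2 * c := by gcongr; exact htay i s t
          _ = M * (c * |t - s| * |t - s|) := by ring
          _ ≤ _ := by gcongr
    have h1 : unitTangent γ (γ i t) / (γ i t - γ i s) -
        conj (unitTangent γ (γ i t) / (γ i t - γ i s)) = b - conj b := by
      rw [hb, map_sub, Complex.conj_ofReal]
      ring
    rw [h1]
    exact (hconj b).trans (by gcongr)
  · refine le_trans ((hconj _).trans ?_) (le_max_left _ _)
    rw [norm_div, norm_unitTangent hΩ hζ]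
    gcongr
    exact hch' i j t s hij

/-- The Kerzman–Stein operator `𝒞 - 𝒞*` has a bounded kernel: the singularities of `𝒞` and `𝒞*`
cancel. The term `‖u z‖` in the bound comes from the regularization of the Cauchy integrals. -/
theorem exists_kerzmanStein_bound (hΩ : IsSmoothDomain Ω γ) (hφ : BdrySmooth γ φ)
    (hpos : ∀ z ∈ frontier Ω, 0 < φ z) : ∃ K, 0 ≤ K ∧ ∀ u, BdrySmooth γ u → ∀ z ∈ frontier Ω,
      ‖cauchyTransform Ω γ u z - cauchyAdjoint Ω γ φ u z‖ ≤
        K * (‖u z‖ + ∫ ζ, ‖u ζ‖ ∂(arcLength γ)) := by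
  have := isFiniteMeasure_arcLength hΩ
  obtain ⟨M, hM, hMb⟩ := exists_double_layer_bound hΩ
  obtain ⟨LT, hLT, hLTb⟩ := (bdrySmooth_unitTangent hΩ).exists_lipschitz hΩ
  obtain ⟨Lφ, hLφ, hLφb⟩ := hφ.exists_lipschitz hΩ
  obtain ⟨z₀, hz₀, hmin⟩ := (isCompact_frontier hΩ).exists_isMinOn (frontier_nonempty hΩ)
    (continuousOn_of_bdrySmooth hΩ hφ)
  have hm : 0 < φ z₀ := hpos z₀ hz₀
  set c : ℂ := (2 * Real.pi * Complex.I)⁻¹ with hc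
  have hcc : conj c = -c := by
    rw [hc, map_inv₀]
    simp only [map_mul, map_ofNat, Complex.conj_ofReal, Complex.conj_I]
    rw [mul_neg, inv_neg]
  set M' := M + (LT + Lφ * (φ z₀)⁻¹) with hM'
  refine ⟨1 + ‖c‖ * M' * (1 + (arcLength γ).real univ), by positivity, fun u hu z hz => ?_⟩
  set T := unitTangent γ with hT
  set w : ℂ → ℂ := fun ζ => conj (u ζ * (φ ζ : ℂ)) * conj (T ζ) with hw
  have hws : BdrySmooth γ w := bdrySmooth_dual hΩ hφ hu
  have hφz : (φ z : ℂ) ≠ 0 := Complex.ofReal_ne_zero.2 (hpos z hz).ne'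
  have hTz : T z * conj (T z) = 1 := unitTangent_mul_conj hΩ hz
  have hinv : (φ z : ℂ) * (φ z : ℂ)⁻¹ = 1 := mul_inv_cancel₀ hφz
  set Q : ℂ → ℂ := fun ζ => (u ζ - u z) / (ζ - z) * T ζ -
    conj (T z) * (φ z : ℂ)⁻¹ * conj ((w ζ - w z) / (ζ - z) * T ζ) with hQ
  have i1 := integrable_kernel hΩ hu hz
  have i2 : Integrable (fun ζ => conj ((w ζ - w z) / (ζ - z) * T ζ)) (arcLength γ) :=
    Complex.conjLIE.toContinuousLinearEquiv.toContinuousLinearMap.integrable_comp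
      (integrable_kernel hΩ hws hz)
  have hdiff : cauchyTransform Ω γ u z - cauchyAdjoint Ω γ φ u z =
      u z + c * ∫ ζ, Q ζ ∂(arcLength γ) := by
    have hadj : cauchyAdjoint Ω γ φ u z =
        u z - conj (T z) * (φ z : ℂ)⁻¹ * conj (cauchyTransform Ω γ w z) := rfl
    have hwz : conj (w z) = u z * φ z * T z := by simp [hw]
    rw [hadj, cauchyTransform_of_mem_frontier hΩ hu hz, cauchyTransform_of_mem_frontier hΩ hws hz,
      regularizedCauchy, regularizedCauchy, ← hc, map_add, map_mul (starRingEnd ℂ) c, hcc, hwz, hQ,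
      integral_sub i1 (i2.const_mul _), integral_const_mul, integral_conj]
    linear_combination (u z * T z * conj (T z)) * hinv + u z * hTz
  have hQb : ∀ ζ ∈ frontier Ω, ‖Q ζ‖ ≤ M' * (‖u ζ‖ + ‖u z‖) := by
    intro ζ hζ
    have hTζ : T ζ * conj (T ζ) = 1 := unitTangent_mul_conj hΩ hζ
    set k₂ := T ζ / (ζ - z) - conj (T ζ) / conj (ζ - z) with hk₂
    set k₁ := k₂ + ((conj (T ζ) - conj (T z)) + conj (T z) * (φ z - φ ζ) * (φ z : ℂ)⁻¹) /
      conj (ζ - z) with hk₁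
    -- `k₁` is the Kerzman–Stein kernel, `k₂` the double layer kernel
    have hQeq : Q ζ = u ζ * k₁ - u z * k₂ := by
      have h1 : conj ((w ζ - w z) / (ζ - z) * T ζ) =
          (u ζ * φ ζ * T ζ - u z * φ z * T z) / conj (ζ - z) * conj (T ζ) := by
        simp [hw]
      rw [hk₁, hk₂, hQ]
      dsimp only
      rw [h1]
      simp only [div_eq_mul_inv]
      linear_combination
        -(u ζ * φ ζ * (φ z : ℂ)⁻¹ * conj (T z) * (conj (ζ - z))⁻¹) * hTζ +
        (u z * T z * conj (T z) * conj (T ζ) * (conj (ζ - z))⁻¹ -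
          u ζ * conj (T z) * (conj (ζ - z))⁻¹) * hinv +
        (u z * conj (T ζ) * (conj (ζ - z))⁻¹) * hTz
    have h2 : ‖k₂‖ ≤ M' := (hMb z hz ζ hζ).trans (le_add_of_nonneg_right (by positivity))
    have h1 : ‖k₁‖ ≤ M' := by
      refine (norm_add_le _ _).trans (add_le_add (hMb z hz ζ hζ) ?_)
      rw [norm_div, RCLike.norm_conj]
      refine div_le_of_le_mul₀ (norm_nonneg _) (by positivity) ?_
      rw [← map_sub]
      refine (norm_add_le _ _).trans ?_
      rw [RCLike.norm_conj, norm_mul, norm_mul, RCLike.norm_conj, norm_unitTangent hΩ hz,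
        one_mul, norm_inv, Complex.norm_real, ← Complex.ofReal_sub, Complex.norm_real, add_mul]
      have h3 := hLTb ζ hζ z hz
      have h4 := hLφb z hz ζ hζ
      have h5 : ‖φ z‖⁻¹ ≤ (φ z₀)⁻¹ := by
        rw [Real.norm_of_nonneg (hpos z hz).le]
        exact inv_anti₀ hm (hmin hz)
      rw [norm_sub_rev z ζ] at h4
      calc _ ≤ LT * ‖ζ - z‖ + Lφ * ‖ζ - z‖ * (φ z₀)⁻¹ := by gcongr
        _ = _ := by ring
    rw [hQeq]
    refine (norm_sub_le _ _).trans ?_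
    rw [norm_mul, norm_mul, mul_add]
    nlinarith [norm_nonneg (u ζ), norm_nonneg (u z)]
  have hI : ‖∫ ζ, Q ζ ∂(arcLength γ)‖ ≤
      M' * ((∫ ζ, ‖u ζ‖ ∂(arcLength γ)) + (arcLength γ).real univ * ‖u z‖) := by
    have hui := (ContinuousOn.integrable_arcLength hΩ (continuousOn_of_bdrySmooth hΩ hu)).norm
    have h1 := norm_integral_le_of_norm_le ((hui.add (integrable_const ‖u z‖)).const_mul M')
      ((ae_mem_frontier hΩ).mono hQb)
    refine h1.trans_eq ?_
    rw [integral_const_mul]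
    congr 1
    simp only [Pi.add_apply]
    rw [integral_add hui (integrable_const _), integral_const, smul_eq_mul]
  have hu0 : 0 ≤ ∫ ζ, ‖u ζ‖ ∂(arcLength γ) := integral_nonneg fun _ => norm_nonneg _
  rw [hdiff]
  refine (norm_add_le _ _).trans ?_
  rw [norm_mul]
  set I := ∫ ζ, ‖u ζ‖ ∂(arcLength γ)
  set S := (arcLength γ).real univ
  have hS : 0 ≤ S := measureReal_nonneg
  calc _ ≤ ‖u z‖ + ‖c‖ * (M' * (I + S * ‖u z‖)) := by gcongr
    _ ≤ ‖u z‖ + ‖c‖ * (M' * (I + S * ‖u z‖)) + (I + ‖c‖ * M' * ‖u z‖ + ‖c‖ * M' * (S * I)) :=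
      le_add_of_nonneg_right (by positivity)
    _ = _ := by ring

/-! ### The Cauchy transform on `L²` -/

theorem toL2_congr (hΩ : IsSmoothDomain Ω γ) (hφ : BdrySmooth γ φ) {u v : ℂ → ℂ}
    (hu : BdrySmooth γ u) (hv : BdrySmooth γ v) (h : EqOn u v (frontier Ω)) :
    toL2 hΩ hφ hu = toL2 hΩ hφ hv :=
  MemLp.toLp_congr _ _ ((weightedArc_ae_mem hΩ).mono h)

/-- The inner product of `L2` is conjugate linear in the first variable, `wInner` in the second. -/
theorem inner_toL2 (hΩ : IsSmoothDomain Ω γ) (hφ : BdrySmooth γ φ) {u v : ℂ → ℂ}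
    (hu : BdrySmooth γ u) (hv : BdrySmooth γ v) :
    inner ℂ (toL2 hΩ hφ hu) (toL2 hΩ hφ hv) = wInner γ φ v u := by
  rw [L2.inner_def, wInner]
  refine integral_congr_ae ?_
  filter_upwards [(BdrySmooth.memLp hΩ hφ hu).coeFn_toLp,
    (BdrySmooth.memLp hΩ hφ hv).coeFn_toLp] with z h1 h2
  rw [toL2, toL2, h1, h2, RCLike.inner_apply]

/-- The `L¹` norm for arc length is bounded by the weighted `L²` norm, by the Cauchy–Schwarz
inequality with the constant function `1`, since `φ` is bounded from below. -/
theorem integral_norm_le (hΩ : IsSmoothDomain Ω γ) (hφ : BdrySmooth γ φ)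
    (hpos : ∀ z ∈ frontier Ω, 0 < φ z) : ∃ C, 0 ≤ C ∧ ∀ (u : ℂ → ℂ) (hu : BdrySmooth γ u),
      ∫ ζ, ‖u ζ‖ ∂(arcLength γ) ≤ C * ‖toL2 hΩ hφ hu‖ := by
  have := isFiniteMeasure_weightedArc hΩ hφ
  obtain ⟨z₀, hz₀, hmin⟩ := (isCompact_frontier hΩ).exists_isMinOn (frontier_nonempty hΩ)
    (continuousOn_of_bdrySmooth hΩ hφ)
  have hm : 0 < φ z₀ := hpos z₀ hz₀
  set one : Lp ℝ 2 (weightedArc γ φ) := (memLp_const (1 : ℝ)).toLp _ with hone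
  refine ⟨(φ z₀)⁻¹ * ‖one‖, by positivity, fun u hu => ?_⟩
  have hmem := BdrySmooth.memLp hΩ hφ hu
  set f : Lp ℝ 2 (weightedArc γ φ) := hmem.norm.toLp _ with hf
  have hfn : ‖f‖ = ‖toL2 hΩ hφ hu‖ := by
    rw [hf, toL2, Lp.norm_toLp, Lp.norm_toLp, eLpNorm_norm]
  have h1 : inner ℝ one f = ∫ ζ, φ ζ * ‖u ζ‖ ∂(arcLength γ) := by
    simp_rw [← smul_eq_mul]
    rw [← integral_weightedArc hΩ hφ hpos (fun ζ => ‖u ζ‖), L2.inner_def]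
    refine integral_congr_ae ?_
    filter_upwards [hmem.norm.coeFn_toLp,
      (memLp_const (μ := weightedArc γ φ) (p := 2) (1 : ℝ)).coeFn_toLp] with z h1 h2
    rw [hone, hf, h1, h2, RCLike.inner_apply]
    simp
  have hcu := continuousOn_of_bdrySmooth hΩ hu
  have h2 : φ z₀ * ∫ ζ, ‖u ζ‖ ∂(arcLength γ) ≤ ∫ ζ, φ ζ * ‖u ζ‖ ∂(arcLength γ) := by
    rw [← integral_const_mul]
    refine integral_mono_ae
      (ContinuousOn.integrable_arcLength hΩ (continuousOn_const.fun_mul hcu.norm))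
      (ContinuousOn.integrable_arcLength hΩ
        ((continuousOn_of_bdrySmooth hΩ hφ).fun_mul hcu.norm)) ?_
    filter_upwards [ae_mem_frontier hΩ] with z hz
    exact mul_le_mul_of_nonneg_right (hmin hz) (norm_nonneg _)
  have h3 := (le_abs_self _).trans (abs_real_inner_le_norm one f)
  rw [mul_assoc, inv_mul_eq_div, le_div_iff₀ hm, mul_comm, ← hfn]
  linarith

/-- The Kerzman–Stein operator is bounded on `L²`. -/
theorem exists_norm_kerzmanStein_le (hΩ : IsSmoothDomain Ω γ) (hφ : BdrySmooth γ φ)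
    (hpos : ∀ z ∈ frontier Ω, 0 < φ z) : ∃ A, 0 ≤ A ∧ ∀ (u : ℂ → ℂ) (hu : BdrySmooth γ u),
      ‖toL2 hΩ hφ (bdrySmooth_cauchyTransform hΩ hu) -
        toL2 hΩ hφ (bdrySmooth_cauchyAdjoint hΩ hφ hpos hu)‖ ≤ A * ‖toL2 hΩ hφ hu‖ := by
  have := isFiniteMeasure_weightedArc hΩ hφ
  obtain ⟨K, hK, hKb⟩ := exists_kerzmanStein_bound hΩ hφ hpos
  obtain ⟨C, hC, hCb⟩ := integral_norm_le hΩ hφ hpos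
  set one : Lp ℝ 2 (weightedArc γ φ) := (memLp_const (1 : ℝ)).toLp _ with hone
  refine ⟨K * (1 + C * ‖one‖), by positivity, fun u hu => ?_⟩
  have hmem := BdrySmooth.memLp hΩ hφ hu
  set f : Lp ℝ 2 (weightedArc γ φ) := hmem.norm.toLp _ with hf
  have hfn : ‖f‖ = ‖toL2 hΩ hφ hu‖ := by
    rw [hf, toL2, Lp.norm_toLp, Lp.norm_toLp, eLpNorm_norm]
  set I := ∫ ζ, ‖u ζ‖ ∂(arcLength γ) with hI
  have hI0 : 0 ≤ I := integral_nonneg fun _ => norm_nonneg _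
  have hle : ‖toL2 hΩ hφ (bdrySmooth_cauchyTransform hΩ hu) -
      toL2 hΩ hφ (bdrySmooth_cauchyAdjoint hΩ hφ hpos hu)‖ ≤ ‖K • (f + I • one)‖ := by
    refine Lp.norm_le_norm_of_ae_le ?_
    filter_upwards [weightedArc_ae_mem hΩ,
      Lp.coeFn_sub (toL2 hΩ hφ (bdrySmooth_cauchyTransform hΩ hu))
        (toL2 hΩ hφ (bdrySmooth_cauchyAdjoint hΩ hφ hpos hu)),
      (BdrySmooth.memLp hΩ hφ (bdrySmooth_cauchyTransform hΩ hu)).coeFn_toLp,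
      (BdrySmooth.memLp hΩ hφ (bdrySmooth_cauchyAdjoint hΩ hφ hpos hu)).coeFn_toLp,
      Lp.coeFn_smul K (f + I • one), Lp.coeFn_add f (I • one), Lp.coeFn_smul I one,
      hmem.norm.coeFn_toLp, (memLp_const (μ := weightedArc γ φ) (p := 2) (1 : ℝ)).coeFn_toLp]
      with z hz h1 h2 h3 h4 h5 h6 h7 h8
    rw [h1, Pi.sub_apply, toL2, toL2, h2, h3, h4, Pi.smul_apply, h5, Pi.add_apply, h6,
      Pi.smul_apply, hf, h7, hone, h8, smul_eq_mul, smul_eq_mul, mul_one]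
    exact (hKb u hu z hz).trans (le_abs_self _)
  refine hle.trans ?_
  rw [norm_smul, Real.norm_of_nonneg hK, mul_assoc]
  refine mul_le_mul_of_nonneg_left ?_ hK
  refine (norm_add_le _ _).trans ?_
  rw [norm_smul, Real.norm_of_nonneg hI0, hfn]
  have h1 := mul_le_mul_of_nonneg_right (hCb u hu) (norm_nonneg one)
  linarith

/-- The Cauchy transform is bounded on `L²`: since `𝒞² = 𝒞`, one has
`‖𝒞 u‖² = ⟨u, 𝒞* 𝒞 u⟩ = ⟨u, 𝒞 u⟩ - ⟨u, (𝒞 - 𝒞*) 𝒞 u⟩`, and `𝒞 - 𝒞*` is bounded. -/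
theorem exists_norm_cauchyTransform_le (hΩ : IsSmoothDomain Ω γ) (hφ : BdrySmooth γ φ)
    (hpos : ∀ z ∈ frontier Ω, 0 < φ z) : ∃ A, 0 ≤ A ∧ ∀ (u : ℂ → ℂ) (hu : BdrySmooth γ u),
      ‖toL2 hΩ hφ (bdrySmooth_cauchyTransform hΩ hu)‖ ≤ A * ‖toL2 hΩ hφ hu‖ := by
  obtain ⟨A, hA, hAb⟩ := exists_norm_kerzmanStein_le hΩ hφ hpos
  refine ⟨1 + A, by positivity, fun u hu => ?_⟩
  have hCu := bdrySmooth_cauchyTransform hΩ hu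
  set c := toL2 hΩ hφ hCu with hc
  set d := toL2 hΩ hφ (bdrySmooth_cauchyAdjoint hΩ hφ hpos hCu) with hd
  have h1 : inner ℂ c c = inner ℂ d (toL2 hΩ hφ hu) := by
    rw [hc, hd, inner_toL2, inner_toL2, wInner_cauchyTransform hΩ hφ hpos hu hCu]
  have h2 : toL2 hΩ hφ (bdrySmooth_cauchyTransform hΩ hCu) = c :=
    toL2_congr hΩ hφ _ _ fun z hz =>
      cauchyTransform_eq_self hΩ (memAInf_cauchyTransform hΩ hu) (frontier_subset_closure hz)
  have h3 := hAb _ hCu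
  rw [h2, ← hc, ← hd] at h3
  have h4 : ‖d‖ ≤ (1 + A) * ‖c‖ := by
    have := norm_le_norm_add_norm_sub' d c
    rw [norm_sub_rev] at this
    linarith [norm_sub_rev c d]
  have h5 : ‖c‖ * ‖c‖ ≤ (1 + A) * ‖toL2 hΩ hφ hu‖ * ‖c‖ := by
    rw [← inner_self_eq_norm_mul_norm (𝕜 := ℂ), h1]
    refine (RCLike.re_le_norm _).trans ((norm_inner_le_norm _ _).trans ?_)
    rw [mul_right_comm]
    exact mul_le_mul_of_nonneg_right h4 (norm_nonneg _)
  rcases (norm_nonneg c).eq_or_lt with h0 | h0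
  · rw [← h0]; positivity
  · exact le_of_mul_le_mul_right h5 h0

theorem regularizedCauchy_add (hΩ : IsSmoothDomain Ω γ) {u v : ℂ → ℂ} (hu : BdrySmooth γ u)
    (hv : BdrySmooth γ v) {z : ℂ} (hz : z ∈ frontier Ω) :
    regularizedCauchy γ (u + v) z = regularizedCauchy γ u z + regularizedCauchy γ v z := by
  rw [regularizedCauchy, regularizedCauchy, regularizedCauchy, ← mul_add,
    ← integral_add (integrable_kernel hΩ hu hz) (integrable_kernel hΩ hv hz)]
  congr 2
  funext ζ
  simp only [Pi.add_apply]
  ring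

theorem regularizedCauchy_smul (c : ℂ) (u : ℂ → ℂ) (z : ℂ) :
    regularizedCauchy γ (c • u) z = c * regularizedCauchy γ u z := by
  rw [regularizedCauchy, regularizedCauchy, mul_left_comm, ← integral_const_mul c]
  congr 2
  funext ζ
  simp only [Pi.smul_apply, smul_eq_mul]
  ring

/-- `C^∞(∂Ω)` as a space of functions on the plane. -/
def smoothBdry (γ : Fin n → ℝ → ℂ) : Submodule ℂ (ℂ → ℂ) where
  carrier := {u | BdrySmooth γ u}
  zero_mem' := bdrySmooth_const (γ := γ) 0
  add_mem' hu hv i := (hu i).add (hv i)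
  smul_mem' c _ hu i := (hu i).const_smul c

/-- The map from `C^∞(∂Ω)` to `L²`. It is not injective, as functions on the plane with the same
restriction to `∂Ω` are not identified in `smoothBdry`. -/
def toL2Linear (hΩ : IsSmoothDomain Ω γ) (hφ : BdrySmooth γ φ) :
    smoothBdry γ →ₗ[ℂ] L2 γ φ where
  toFun u := toL2 hΩ hφ u.2
  map_add' _ _ := rfl
  map_smul' _ _ := rfl

/-- The Cauchy transform as a linear map from `C^∞(∂Ω)` to `L²`. -/
def cauchyLinear (hΩ : IsSmoothDomain Ω γ) (hφ : BdrySmooth γ φ) :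
    smoothBdry γ →ₗ[ℂ] L2 γ φ where
  toFun u := toL2 hΩ hφ (bdrySmooth_cauchyTransform hΩ u.2)
  map_add' u v := by
    have hs := (smoothBdry γ).add_mem (bdrySmooth_cauchyTransform hΩ u.2)
      (bdrySmooth_cauchyTransform hΩ v.2)
    change _ = toL2 hΩ hφ hs
    refine toL2_congr hΩ hφ _ _ fun z hz => ?_
    rw [Pi.add_apply, cauchyTransform_of_mem_frontier hΩ (u + v).2 hz,
      cauchyTransform_of_mem_frontier hΩ u.2 hz, cauchyTransform_of_mem_frontier hΩ v.2 hz,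
      Submodule.coe_add, Pi.add_apply, regularizedCauchy_add hΩ u.2 v.2 hz]
    ring
  map_smul' c u := by
    have hs := (smoothBdry γ).smul_mem c (bdrySmooth_cauchyTransform hΩ u.2)
    change _ = toL2 hΩ hφ hs
    refine toL2_congr hΩ hφ _ _ fun z hz => ?_
    rw [Pi.smul_apply, cauchyTransform_of_mem_frontier hΩ (c • u).2 hz,
      cauchyTransform_of_mem_frontier hΩ u.2 hz, Submodule.coe_smul, Pi.smul_apply,
      regularizedCauchy_smul, smul_eq_mul, smul_eq_mul]
    ring

/-- `C^∞(∂Ω)` is dense in `L²`, since it contains the restrictions of smooth functions on the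
plane. -/
theorem denseRange_toL2Linear (hΩ : IsSmoothDomain Ω γ) (hφ : BdrySmooth γ φ) :
    DenseRange (toL2Linear hΩ hφ) := by
  have := isFiniteMeasure_weightedArc hΩ hφ
  refine (Lp.dense_hasCompactSupport_contDiff (F := ℂ) (μ := weightedArc γ φ) (p := 2)
    (by simp)).mono ?_
  rintro f ⟨g, hfg, -, hg⟩
  have hgs : BdrySmooth γ g := fun i => hg.comp (hΩ.contDiff i)
  refine ⟨⟨g, hgs⟩, ?_⟩
  exact Lp.ext ((BdrySmooth.memLp hΩ hφ hgs).coeFn_toLp.trans hfg.symm)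

/-! ### The Kerzman–Stein formula -/

/-- The weighted Kerzman–Stein formula for smooth functions: `𝒞 u` lies in the Hardy space, and
`u - 𝒞* u` is orthogonal to it because `𝒞` is the identity on `A^∞`. -/
theorem szegoProj_kerzmanStein (hΩ : IsSmoothDomain Ω γ) (hφ : BdrySmooth γ φ)
    (hpos : ∀ z ∈ frontier Ω, 0 < φ z) {u : ℂ → ℂ} (hu : BdrySmooth γ u)
    (hCu : BdrySmooth γ (cauchyTransform Ω γ u)) (hCu' : BdrySmooth γ (cauchyAdjoint Ω γ φ u)) :
    szegoProj Ω hΩ.isOpen γ φ (toL2 hΩ hφ hu + (toL2 hΩ hφ hCu - toL2 hΩ hφ hCu')) =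
      toL2 hΩ hφ hCu := by
  refine Submodule.eq_starProjection_of_mem_orthogonal (Submodule.le_topologicalClosure _ ?_) ?_
  · exact ⟨_, memAInf_cauchyTransform hΩ hu, (BdrySmooth.memLp hΩ hφ hCu).coeFn_toLp⟩
  · rw [Submodule.orthogonal_closure, Submodule.mem_orthogonal]
    rintro f ⟨h, hh, hfh⟩
    have hhs := hh.bdrySmooth hΩ
    have hf : f = toL2 hΩ hφ hhs :=
      Lp.ext (hfh.trans (BdrySmooth.memLp hΩ hφ hhs).coeFn_toLp.symm)
    have h1 : toL2 hΩ hφ (bdrySmooth_cauchyTransform hΩ hhs) = toL2 hΩ hφ hhs :=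
      toL2_congr hΩ hφ _ _ fun z hz =>
        cauchyTransform_eq_self hΩ hh (frontier_subset_closure hz)
    have h2 : inner ℂ (toL2 hΩ hφ hCu') (toL2 hΩ hφ hhs) =
        inner ℂ (toL2 hΩ hφ hu) (toL2 hΩ hφ hhs) := by
      conv_rhs => rw [← h1]
      rw [inner_toL2, inner_toL2, wInner_cauchyTransform hΩ hφ hpos hhs hu]
    rw [hf, ← inner_conj_symm, add_sub_assoc, sub_sub_cancel_left, ← sub_eq_add_neg,
      inner_sub_left, h2, sub_self, map_zero]

/-- On `C^∞(∂Ω)` the Hilbert space adjoint of an extension of `𝒞` is the formal adjoint `𝒞*`. -/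
theorem adjoint_toL2 (hΩ : IsSmoothDomain Ω γ) (hφ : BdrySmooth γ φ)
    (hpos : ∀ z ∈ frontier Ω, 0 < φ z) {K : L2 γ φ →L[ℂ] L2 γ φ} (hK : ExtendsCauchy hΩ hφ K)
    {v : ℂ → ℂ} (hv : BdrySmooth γ v) :
    ContinuousLinearMap.adjoint K (toL2 hΩ hφ hv) =
      toL2 hΩ hφ (bdrySmooth_cauchyAdjoint hΩ hφ hpos hv) := by
  refine Dense.eq_of_inner_left ℂ (denseRange_toL2Linear hΩ hφ) ?_
  rintro _ ⟨⟨u, hu : BdrySmooth γ u⟩, rfl⟩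
  obtain ⟨hCu, h⟩ := hK u hu
  change inner ℂ _ (toL2 hΩ hφ hu) = inner ℂ _ (toL2 hΩ hφ hu)
  rw [ContinuousLinearMap.adjoint_inner_left, h, inner_toL2, inner_toL2,
    wInner_cauchyTransform hΩ hφ hpos hu hv]

theorem existsUnique_extendsCauchy (hΩ : IsSmoothDomain Ω γ) (hφ : BdrySmooth γ φ)
    (hpos : ∀ z ∈ frontier Ω, 0 < φ z) :
    ∃! K : L2 γ φ →L[ℂ] L2 γ φ, ExtendsCauchy hΩ hφ K := by
  have hdense := denseRange_toL2Linear hΩ hφ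
  obtain ⟨A, -, hA⟩ := exists_norm_cauchyTransform_le hΩ hφ hpos
  refine ⟨(cauchyLinear hΩ hφ).extendOfNorm (toL2Linear hΩ hφ), fun u hu =>
    ⟨bdrySmooth_cauchyTransform hΩ hu, ?_⟩, fun K hK => ?_⟩
  · exact LinearMap.extendOfNorm_eq hdense ⟨A, fun x => hA x x.2⟩ ⟨u, hu⟩
  · refine (LinearMap.extendOfNorm_unique hdense A (fun x => hA x x.2) K ?_).symm
    ext u : 1
    exact (hK u u.2).2

theorem szegoProj_comp_eq (hΩ : IsSmoothDomain Ω γ) (hφ : BdrySmooth γ φ)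
    (hpos : ∀ z ∈ frontier Ω, 0 < φ z) {K : L2 γ φ →L[ℂ] L2 γ φ} (hK : ExtendsCauchy hΩ hφ K) :
    szegoProj Ω hΩ.isOpen γ φ ∘L
      (ContinuousLinearMap.id ℂ (L2 γ φ) + (K - ContinuousLinearMap.adjoint K)) = K := by
  refine DFunLike.coe_injective ((denseRange_toL2Linear hΩ hφ).equalizer
    (ContinuousLinearMap.continuous _) (ContinuousLinearMap.continuous _) ?_)
  funext u
  obtain ⟨hCu, h⟩ := hK u u.2
  change szegoProj Ω hΩ.isOpen γ φ (toL2 hΩ hφ u.2 + (K (toL2 hΩ hφ u.2) -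
    ContinuousLinearMap.adjoint K (toL2 hΩ hφ u.2))) = K (toL2 hΩ hφ u.2)
  rw [h, adjoint_toL2 hΩ hφ hpos hK u.2]
  exact szegoProj_kerzmanStein hΩ hφ hpos u.2 hCu _

end WeightedSzego

end

theorem proposition2p1 {n : ℕ} {Ω : Set ℂ} {γ : Fin n → ℝ → ℂ} (hΩ : IsSmoothDomain Ω γ)
    {φ : ℂ → ℝ} (hφ : BdrySmooth γ φ) (hpos : ∀ z ∈ frontier Ω, 0 < φ z) :
    -- the Cauchy transform maps `C^∞(∂Ω)` into `A^∞(Ω)`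
    (∀ u : ℂ → ℂ, BdrySmooth γ u →
      EqOn (cauchyTransform Ω γ u) (cauchyIntegral γ u) Ω ∧ MemAInf Ω (cauchyTransform Ω γ u)) ∧
    -- the Kerzman-Stein formula on `C^∞(∂Ω)`, with both operators acting on `C^∞(∂Ω)`
    (∀ (u : ℂ → ℂ) (hu : BdrySmooth γ u),
      ∃ (hCu : BdrySmooth γ (cauchyTransform Ω γ u)) (hCu' : BdrySmooth γ (cauchyAdjoint Ω γ φ u)),
        szegoProj Ω hΩ.isOpen γ φ
          (toL2 hΩ hφ hu + (toL2 hΩ hφ hCu - toL2 hΩ hφ hCu')) = toL2 hΩ hφ hCu) ∧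
    -- `𝒞*_φ` is the adjoint of `𝒞` for the weighted inner product
    (∀ u v : ℂ → ℂ, BdrySmooth γ u → BdrySmooth γ v →
      wInner γ φ (cauchyTransform Ω γ u) v = wInner γ φ u (cauchyAdjoint Ω γ φ v)) ∧
    -- the Kerzman-Stein formula on `L²_φ(∂Ω)`
    (∃! K : L2 γ φ →L[ℂ] L2 γ φ, ExtendsCauchy hΩ hφ K) ∧
    (∀ K : L2 γ φ →L[ℂ] L2 γ φ, ExtendsCauchy hΩ hφ K →
      szegoProj Ω hΩ.isOpen γ φ ∘L
        (ContinuousLinearMap.id ℂ (L2 γ φ) + (K - ContinuousLinearMap.adjoint K)) = K) := by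
  refine ⟨fun u hu => ⟨fun z hz => cauchyTransform_of_mem hΩ hu hz, memAInf_cauchyTransform hΩ hu⟩,
    fun u hu => ⟨bdrySmooth_cauchyTransform hΩ hu, bdrySmooth_cauchyAdjoint hΩ hφ hpos hu,
      szegoProj_kerzmanStein hΩ hφ hpos hu _ _⟩,
    fun u v hu hv => wInner_cauchyTransform hΩ hφ hpos hu hv,
    existsUnique_extendsCauchy hΩ hφ hpos, fun K hK => szegoProj_comp_eq hΩ hφ hpos hK⟩
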